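/- Let $\kappa>0$, $1<\gamma<3$, $d\in\mathbb N$ and $A_1,\dots,A_d>0$. Put $\theta=\frac{\gamma-1}{2}$, $\lambda=\frac1{\gamma-1}-\frac12$, $a=\frac{2\sqrt{\gamma\kappa}}{\gamma-1}$, $J=\int_{-1}^1(1-z^2)^\lambda\,dz$, $c=a^{-2/(\gamma-1)}/J$, $\chi(\rho,\xi)=c\,(a^2\rho^{\gamma-1}-\xi^2)_+^\lambda$, and $D=\{(\rho,u)\in\mathbb R^2:\rho>0\text{ or }\rho=u=0\}$. For convex $S\colon\mathbb R\to\mathbb R$ and $(\rho,u)\in D$ let $$\eta_S(\rho,u)=\int_{\mathbb R}\chi(\rho,v-u)S(v)\,dv,\qquad G_S(\rho,u)=\int_{\mathbb R}[(1-\theta)u+\theta v]\,\chi(\rho,v-u)S(v)\,dv .$$ Consider the isentropic gas equations $\partial_t\rho+\partial_x(\rho u)=0$, $\partial_t(\rho u)+\partial_x(\rho u^2+\kappa\rho^\gamma)=0$. For $w_l,w_r\in D$ let $\mathcal{RP}(w_l,w_r)(x/t)$ be the self-similar Lax solution of the Riemann problem with states $w_l$ for $x<0$ and $w_r$ for $x>0$: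 a 1-wave followed by a 2-wave, each a Lax shock or a centred rarefaction, with a vacuum state $(0,0)$ bounded by complete rarefactions (absent next to a vacuum datum) if $w_l$ or $w_r$ is vacuum or if $u_l+a\rho_l^\theta\le u_r-a\rho_r^\theta$. For $b\in D$ let $\mathcal V(b)=\{\mathcal{RP}(b,w_r)(0+): w_r\in D\}\subset D$. For states $(\rho_k,u_k)(t,x)$, $t,x>0$, $k=1,\dots,d$, the trace $(\bar\rho_k,\bar u_k)(t)=(\rho_k,u_k)(t,0+)\in D$ is understood, for a.e. $t$, as the essential limit of $(\rho_k,\rho_ku_k)(t,x)$ as $x\to0+$ being $(\bar\rho_k,\bar\rho_k\bar u_k)(t)$. Generalized Riemann problem. Given $(\hat\rho_k,\hat u_k)\in D$, functions $(\rho_k,u_k)\colon(0,\infty)_t\times(0,\infty)_x\to D$ are a solution if they have traces as above and (RP0) $(\rho_k,u_k)(0+,x)=(\hat\rho_k,\hat u_k)$ for all $x>0$ and all $k$; (RP1) there is $\rho_*\ge0$ with $(\rho_k,u_k)(t,x)=\mathcal{RP}((\rho_*,0),(\hat\rho_k,\hat u_k))(x/t)$ for a.e. $t,x>0$ and all $k$;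 (RP2) $\sum_{k=1}^dA_k\bar\rho_k\bar u_k=0$ for a.e. $t>0$. Generalized Cauchy problem. Given $T\in(0,\infty]$, a constant vector $U^0\in\mathbb R^{2d}$ and initial data $(\hat\rho_k,\hat u_k)(x)\in D$ (a.e. $x>0$) with $(\hat\rho_k,\hat\rho_k\hat u_k)_k\in U^0+L^1(0,\infty)$, a family $(\rho_k,\rho_ku_k)_k\in C([0,T],U^0+L^1(0,\infty))$ with $(\rho_k,u_k)\in D$ a.e. is a solution if each $(\rho_k,u_k)$ is a weak entropy solution on $(0,T)\times(0,\infty)$ (it has locally integrable fluxes, satisfies the equations in the sense of distributions, and satisfies $\partial_t\eta_S+\partial_xG_S\le0$ in the sense of distributions for every convex $S$ for which $\eta_S$ and $G_S$ of the solution are locally integrable), has a trace as above for a.e. $t\in(0,T)$, and (CP0) $(\rho_k,u_k)(0,x)=(\hat\rho_k,\hat u_k)(x)$ for a.e. $x>0$ and all $k$; (CP1) for a.e. $t\in(0,T)$ there is $\rho_*(t)\ge0$ with $(\bar\rho_k,\bar u_k)(t)\in\mathcal V(\rho_*(t),0)$ for all $k$; (CP2) $\sum_{k=1}^dA_k\bar\rho_k\bar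 u_k=0$ for a.e. $t\in(0,T)$. Proposition. Let $(\rho_k,u_k)_{k=1,\dots,d}$ be a solution of the generalized Riemann problem or of the generalized Cauchy problem. Then, for every convex $S\colon\mathbb R\to\mathbb R$ with $S(v)=S(-v)$ for all $v$, $$\sum_{k=1}^dA_k\,G_S\big(\bar\rho_k(t),\bar u_k(t)\big)\le0$$ for a.e. $t>0$ (for a.e. $t\in(0,T)$ in the Cauchy case). -/

import Mathlib

open MeasureTheory Set Filter Topology
open scoped ContDiff

namespace IsentropicGas

/-- The state space `D`; states are written `(ρ, u)`, density and velocity, and the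
only vacuum state is `(0, 0)`. -/
def stateSpace : Set (ℝ × ℝ) := {w | 0 < w.1 ∨ (w.1 = 0 ∧ w.2 = 0)}

/-- The conserved quantities `(ρ, ρ u)` of a state `(ρ, u)`. -/
def cons (w : ℝ × ℝ) : ℝ × ℝ := (w.1, w.1 * w.2)

/-! ### Constants, eigenvalues and Riemann invariants -/

noncomputable def theta (γ : ℝ) : ℝ := (γ - 1) / 2

noncomputable def lam (γ : ℝ) : ℝ := 1 / (γ - 1) - 1 / 2

noncomputable def aConst (κ γ : ℝ) : ℝ := 2 * Real.sqrt (γ * κ) / (γ - 1)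

noncomputable def JConst (γ : ℝ) : ℝ := ∫ z in (-1 : ℝ)..1, (1 - z ^ 2) ^ lam γ

/-- The normalization for which `∫ χ(ρ, v) dv = ρ`. -/
noncomputable def cConst (κ γ : ℝ) : ℝ := aConst κ γ ^ (-(2 / (γ - 1))) / JConst γ

/-- First Riemann invariant `ω₁ = u - a ρ^θ`. -/
noncomputable def omega1 (κ γ : ℝ) (w : ℝ × ℝ) : ℝ := w.2 - aConst κ γ * w.1 ^ theta γ

/-- Second Riemann invariant `ω₂ = u + a ρ^θ`. -/
noncomputable def omega2 (κ γ : ℝ) (w : ℝ × ℝ) : ℝ := w.2 + aConst κ γ * w.1 ^ theta γ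

/-- First eigenvalue `λ₁ = u - √(κγ) ρ^θ`. -/
noncomputable def lambda1 (κ γ : ℝ) (w : ℝ × ℝ) : ℝ :=
  w.2 - Real.sqrt (κ * γ) * w.1 ^ theta γ

/-- Second eigenvalue `λ₂ = u + √(κγ) ρ^θ`. -/
noncomputable def lambda2 (κ γ : ℝ) (w : ℝ × ℝ) : ℝ :=
  w.2 + Real.sqrt (κ * γ) * w.1 ^ theta γ

/-! ### Entropy pairs -/

/-- The kernel `χ(ρ, ξ) = c (a² ρ^(γ-1) - ξ²)₊^λ`. -/
noncomputable def chi (κ γ ρ ξ : ℝ) : ℝ :=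
  cConst κ γ * (max (aConst κ γ ^ 2 * ρ ^ (γ - 1) - ξ ^ 2) 0) ^ lam γ

/-- The entropy `η_S(ρ, u)`. -/
noncomputable def eta (κ γ : ℝ) (S : ℝ → ℝ) (w : ℝ × ℝ) : ℝ :=
  ∫ v, chi κ γ w.1 (v - w.2) * S v

/-- The entropy flux `G_S(ρ, u)`. -/
noncomputable def entropyFlux (κ γ : ℝ) (S : ℝ → ℝ) (w : ℝ × ℝ) : ℝ :=
  ∫ v, ((1 - theta γ) * w.2 + theta γ * v) * chi κ γ w.1 (v - w.2) * S v

/-! ### Lax wave curves and self-similar Lax solutions of Riemann problems -/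

/-- The velocity jump across a shock between the densities `ρ` and `ρ₀`. -/
noncomputable def shockJump (κ γ ρ ρ₀ : ℝ) : ℝ :=
  Real.sqrt (κ * (ρ ^ γ - ρ₀ ^ γ) * (ρ - ρ₀) / (ρ * ρ₀))

/-- The forward `1`-wave curve `𝒲₁(w₀)` (non-vacuum states): rarefaction branch for
`ρ ≤ ρ₀`, shock branch for `ρ > ρ₀`. -/
def waveCurve1 (κ γ : ℝ) (w₀ : ℝ × ℝ) : Set (ℝ × ℝ) :=
  {w | 0 < w.1 ∧
    ((w.1 ≤ w₀.1 ∧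
        w.2 = w₀.2 + aConst κ γ * w₀.1 ^ theta γ - aConst κ γ * w.1 ^ theta γ) ∨
     (w₀.1 < w.1 ∧ w.2 = w₀.2 - shockJump κ γ w.1 w₀.1))}

/-- The forward `2`-wave curve `𝒲₂(w₀)` (non-vacuum states): rarefaction branch for
`ρ ≥ ρ₀`, shock branch for `ρ < ρ₀`. -/
def waveCurve2 (κ γ : ℝ) (w₀ : ℝ × ℝ) : Set (ℝ × ℝ) :=
  {w | 0 < w.1 ∧
    ((w₀.1 ≤ w.1 ∧
        w.2 = w₀.2 - aConst κ γ * w₀.1 ^ theta γ + aConst κ γ * w.1 ^ theta γ) ∨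
     (w.1 < w₀.1 ∧ w.2 = w₀.2 - shockJump κ γ w.1 w₀.1))}

/-- Rankine–Hugoniot speed of a discontinuity between states of different density. -/
noncomputable def shockSpeed (w₀ w : ℝ × ℝ) : ℝ :=
  (w.1 * w.2 - w₀.1 * w₀.2) / (w.1 - w₀.1)

/-- The state at `x / t = ξ` inside the centred `1`-rarefaction fan issuing from the left
state `l`: the state with `λ₁ = ξ` and `ω₂ = ω₂(l)`. -/
noncomputable def fan1 (κ γ : ℝ) (l : ℝ × ℝ) (ξ : ℝ) : ℝ × ℝ :=
  (((omega2 κ γ l - ξ) / (aConst κ γ * (1 + theta γ))) ^ (1 / theta γ),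
   (theta γ * omega2 κ γ l + ξ) / (1 + theta γ))

/-- The state at `x / t = ξ` inside the centred `2`-rarefaction fan ending in the right
state `r`: the state with `λ₂ = ξ` and `ω₁ = ω₁(r)`. -/
noncomputable def fan2 (κ γ : ℝ) (r : ℝ × ℝ) (ξ : ℝ) : ℝ × ℝ :=
  (((ξ - omega1 κ γ r) / (aConst κ γ * (1 + theta γ))) ^ (1 / theta γ),
   (theta γ * omega1 κ γ r + ξ) / (1 + theta γ))

open Classical in
/-- The `1`-wave (rarefaction or shock) from `l` to `m`, as a function of `ξ = x / t`. -/
noncomputable def wave1 (κ γ : ℝ) (l m : ℝ × ℝ) (ξ : ℝ) : ℝ × ℝ :=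
  if m.1 ≤ l.1 then
    if ξ ≤ lambda1 κ γ l then l
    else if ξ < lambda1 κ γ m then fan1 κ γ l ξ
    else m
  else if ξ < shockSpeed l m then l else m

open Classical in
/-- The `2`-wave (rarefaction or shock) from `m` to `r`, as a function of `ξ = x / t`. -/
noncomputable def wave2 (κ γ : ℝ) (m r : ℝ × ℝ) (ξ : ℝ) : ℝ × ℝ :=
  if m.1 ≤ r.1 then
    if ξ ≤ lambda2 κ γ m then m
    else if ξ < lambda2 κ γ r then fan2 κ γ r ξ
    else r
  else if ξ < shockSpeed m r then m else r

open Classical in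
/-- A `1`-wave from `l` to `m` followed by a `2`-wave from `m` to `r`. The `1`-wave is
slower and the `2`-wave is faster than the velocity of the intermediate state `m`. -/
noncomputable def laxProfile (κ γ : ℝ) (l m r : ℝ × ℝ) (ξ : ℝ) : ℝ × ℝ :=
  if ξ < m.2 then wave1 κ γ l m ξ else wave2 κ γ m r ξ

open Classical in
/-- The profile with vacuum: a complete `1`-rarefaction from `l` to vacuum (absent if `l` is
vacuum), vacuum, and a complete `2`-rarefaction from vacuum to `r` (absent if `r` is
vacuum). -/
noncomputable def vacuumProfile (κ γ : ℝ) (l r : ℝ × ℝ) (ξ : ℝ) : ℝ × ℝ :=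
  if l.1 ≠ 0 ∧ ξ < omega2 κ γ l then
    if ξ ≤ lambda1 κ γ l then l else fan1 κ γ l ξ
  else if r.1 ≠ 0 ∧ omega1 κ γ r < ξ then
    if ξ < lambda2 κ γ r then fan2 κ γ r ξ else r
  else (0, 0)

/-- `v` is the profile (a function of `ξ = x / t`) of the self-similar Lax solution of the
Riemann problem with left state `l` and right state `r`. -/
def IsLaxProfile (κ γ : ℝ) (l r : ℝ × ℝ) (v : ℝ → ℝ × ℝ) : Prop :=
  l ∈ stateSpace ∧ r ∈ stateSpace ∧
    ((0 < l.1 ∧ 0 < r.1 ∧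
        ∃ m ∈ waveCurve1 κ γ l, r ∈ waveCurve2 κ γ m ∧ v = laxProfile κ γ l m r) ∨
     ((l.1 = 0 ∨ r.1 = 0 ∨ omega2 κ γ l ≤ omega1 κ γ r) ∧ v = vacuumProfile κ γ l r))

/-- The boundary Riemann set `𝒱(b)`: the values at `x / t = 0+` of the Lax solutions of
Riemann problems with left state `b`. -/
def boundarySet (κ γ : ℝ) (b : ℝ × ℝ) : Set (ℝ × ℝ) :=
  {w | w ∈ stateSpace ∧
    ∃ r ∈ stateSpace, ∃ v, IsLaxProfile κ γ b r v ∧ Tendsto v (𝓝[>] 0) (𝓝 w)}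

/-! ### Traces at the junction -/

/-- `Ubar` is the trace `U(t, 0+)` for a.e. time `t ∈ I`: the conserved quantities of
`U(t, ·)` have, as `x → 0+`, the essential limit given by those of the state
`Ubar t ∈ D`. -/
def IsJunctionTrace (I : Set ℝ) (U : ℝ → ℝ → ℝ × ℝ) (Ubar : ℝ → ℝ × ℝ) : Prop :=
  ∀ᵐ t ∂(volume.restrict I), Ubar t ∈ stateSpace ∧
    Tendsto (fun x => cons (U t x)) (𝓝[>] (0 : ℝ) ⊓ ae volume) (𝓝 (cons (Ubar t)))

/-! ### The generalized Riemann problem -/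

/-- `U k t x = (ρ_k, u_k)(t, x)`, with junction traces `Ubar k t`, solves the generalized
Riemann problem with constant initial states `Uhat k` and cross sections `A k`. -/
structure IsGeneralizedRiemannSolution (κ γ : ℝ) {d : ℕ} (A : Fin d → ℝ)
    (Uhat : Fin d → ℝ × ℝ) (U : Fin d → ℝ → ℝ → ℝ × ℝ) (Ubar : Fin d → ℝ → ℝ × ℝ) :
    Prop where
  mem_stateSpace : ∀ k, ∀ t > 0, ∀ x > 0, U k t x ∈ stateSpace
  initial : ∀ k, ∀ x > 0, Tendsto (fun t => U k t x) (𝓝[>] 0) (𝓝 (Uhat k))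
  lax : ∃ ρstar : ℝ, 0 ≤ ρstar ∧ ∀ k, ∃ v, IsLaxProfile κ γ (ρstar, 0) (Uhat k) v ∧
    ∀ᵐ p : ℝ × ℝ ∂(volume.restrict (Ioi 0 ×ˢ Ioi 0)), U k p.1 p.2 = v (p.2 / p.1)
  trace : ∀ k, IsJunctionTrace (Ioi 0) (U k) (Ubar k)
  mass : ∀ᵐ t ∂(volume.restrict (Ioi (0 : ℝ))),
    ∑ k, A k * ((Ubar k t).1 * (Ubar k t).2) = 0

/-! ### The generalized Cauchy problem -/

/-- The closed time interval `[0, T]`, which is `[0, ∞)` for `T = ∞`. -/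
def closedTimes (T : ENNReal) : Set ℝ := {t | 0 ≤ t ∧ ENNReal.ofReal t ≤ T}

/-- The open time interval `(0, T)`. -/
def openTimes (T : ENNReal) : Set ℝ := {t | 0 < t ∧ ENNReal.ofReal t < T}

/-- The momentum flux `ρ u² + κ ρ^γ`. -/
noncomputable def momentumFlux (κ γ : ℝ) (w : ℝ × ℝ) : ℝ := w.1 * w.2 ^ 2 + κ * w.1 ^ γ

/-- Smooth test functions of `(t, x)` with compact support in `Q`. -/
def IsTestFunction (Q : Set (ℝ × ℝ)) (φ : ℝ × ℝ → ℝ) : Prop :=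
  ContDiff ℝ ∞ φ ∧ HasCompactSupport φ ∧ tsupport φ ⊆ Q

/-- `∬ (f ∂ₜφ + g ∂ₓφ) dt dx` over `Q`. -/
noncomputable def weakPairing (Q : Set (ℝ × ℝ)) (f g φ : ℝ × ℝ → ℝ) : ℝ :=
  ∫ p in Q, (f p * fderiv ℝ φ p (1, 0) + g p * fderiv ℝ φ p (0, 1))

/-- Weak entropy solutions, in the sense of distributions on the open set `Q` of points
`(t, x)`. The entropy inequality is imposed for every convex `S` for which `η_S` and `G_S`
are locally integrable along the solution (for all convex `S` if `ρ` and `u` are bounded). -/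
structure IsWeakEntropySolution (κ γ : ℝ) (Q : Set (ℝ × ℝ)) (U : ℝ → ℝ → ℝ × ℝ) :
    Prop where
  density_integrable : LocallyIntegrableOn (fun p : ℝ × ℝ => (U p.1 p.2).1) Q
  momentum_integrable :
    LocallyIntegrableOn (fun p : ℝ × ℝ => (U p.1 p.2).1 * (U p.1 p.2).2) Q
  flux_integrable : LocallyIntegrableOn (fun p : ℝ × ℝ => momentumFlux κ γ (U p.1 p.2)) Q
  mass_eq : ∀ φ, IsTestFunction Q φ →
    weakPairing Q (fun p => (U p.1 p.2).1) (fun p => (U p.1 p.2).1 * (U p.1 p.2).2) φ = 0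
  momentum_eq : ∀ φ, IsTestFunction Q φ →
    weakPairing Q (fun p => (U p.1 p.2).1 * (U p.1 p.2).2)
      (fun p => momentumFlux κ γ (U p.1 p.2)) φ = 0
  entropy_ineq : ∀ S : ℝ → ℝ, ConvexOn ℝ univ S →
    LocallyIntegrableOn (fun p : ℝ × ℝ => eta κ γ S (U p.1 p.2)) Q →
    LocallyIntegrableOn (fun p : ℝ × ℝ => entropyFlux κ γ S (U p.1 p.2)) Q →
    ∀ φ, IsTestFunction Q φ → (∀ p, 0 ≤ φ p) →
      0 ≤ weakPairing Q (fun p => eta κ γ S (U p.1 p.2))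
        (fun p => entropyFlux κ γ S (U p.1 p.2)) φ

/-- `U k t x = (ρ_k, u_k)(t, x)`, with junction traces `Ubar k t`, solves the generalized
Cauchy problem up to time `T` with initial data `Uhat k x`; `U0` is the constant vector of
conserved quantities such that the solution lies in `C([0, T], U0 + L¹(0, ∞))`. -/
structure IsGeneralizedCauchySolution (κ γ : ℝ) {d : ℕ} (A : Fin d → ℝ) (T : ENNReal)
    (U0 : Fin d → ℝ × ℝ) (Uhat : Fin d → ℝ → ℝ × ℝ) (U : Fin d → ℝ → ℝ → ℝ × ℝ)
    (Ubar : Fin d → ℝ → ℝ × ℝ) : Prop where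
  mem_stateSpace : ∀ k, ∀ t ∈ closedTimes T,
    ∀ᵐ x ∂(volume.restrict (Ioi (0 : ℝ))), U k t x ∈ stateSpace
  integrable : ∀ k, ∀ t ∈ closedTimes T,
    IntegrableOn (fun x => cons (U k t x) - U0 k) (Ioi 0)
  continuous : ∀ k, ∀ t₀ ∈ closedTimes T,
    Tendsto (fun t => ∫ x in Ioi (0 : ℝ), ‖cons (U k t x) - cons (U k t₀ x)‖)
      (𝓝[closedTimes T] t₀) (𝓝 0)
  entropySolution : ∀ k, IsWeakEntropySolution κ γ (openTimes T ×ˢ Ioi 0) (U k)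
  initial : ∀ k, ∀ᵐ x ∂(volume.restrict (Ioi (0 : ℝ))), U k 0 x = Uhat k x
  trace : ∀ k, IsJunctionTrace (openTimes T) (U k) (Ubar k)
  coupling : ∀ᵐ t ∂(volume.restrict (openTimes T)), ∃ ρstar : ℝ, 0 ≤ ρstar ∧
    ∀ k, Ubar k t ∈ boundarySet κ γ (ρstar, 0)
  mass : ∀ᵐ t ∂(volume.restrict (openTimes T)),
    ∑ k, A k * ((Ubar k t).1 * (Ubar k t).2) = 0

end IsentropicGas

/-! The entropy flux of every admissible trace is bounded by one common multiple of its mass flux.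
With `R = a ρ_*^θ` there is a constant `C`, depending only on `S` and `ρ_*`, such that `G_S(w) ≤ C ρ
u` for each `w = (ρ, u)` in `𝒱(ρ_*, 0)`. Weighting by `A_k > 0` and summing, the right side becomes
`C` times the total mass flux, which is zero.

The substitution `v = u + r z`, `r = a ρ^θ`, gives `G_S = (ρ / J) H(u, r)` with `H(U, r) = ∫ (1 -
z²)^λ (U + θ r z) S(U + r z) dz` (`fluxMom`). For even `S`, `H` is odd in `U`, and `C = H_U(0, R) /
J` is the linearization at rest at the density `ρ_*`. It remains to show `H(u, r) ≤ u H_U(0, R)` on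
the states that a Lax solution can leave at `x/t = 0+` (`IsJunctionState`). By oddness, for `u < 0`
this reads `H(V, r) ≥ V H_U(0, R)` with `V = -u`.

(a) `u < 0`, `ρ ≥ ρ_*`: `H` is convex in `V ≥ 0` and vanishes at `0`, so it lies above its tangent
there, and `H_U(0, ·)` is nondecreasing.

(b) `u < 0`, `ρ < ρ_*`, behind a 2-shock that does not enter the pipe: by convexity `H(V, r) / V`
only decreases when `V` is lowered to the speed of the stationary shock joining `ρ` to `ρ_*`. The
entropy inequality for that shock (`fluxMom_stationary_shock`) carries the estimate to the density
`ρ_*`, where the tangent bound applies.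

(c) `u > 0`: the state is on the subsonic part of the 1-rarefaction curve `u + r = R`. There `H(V, R
- V) / V` is nonincreasing and tends to `H_U(0, R)` as `V → 0` (`fluxMom_le_of_rarefaction`).

These estimates use two derivatives of `S`. A general even convex `S` is the limit of its double
averages, which are even, convex and `C²`, and the flux sum passes to the limit. -/

namespace IsentropicGas

/-! ### Weighted moments -/

/-- The moment `∫ (1 - z²)^l z^k f(U + r z) dz` over `[-1, 1]`. -/
noncomputable def mom (l : ℝ) (k : ℕ) (f : ℝ → ℝ) (U r : ℝ) : ℝ :=
  ∫ z in (-1 : ℝ)..1, (1 - z ^ 2) ^ l * (z ^ k * f (U + r * z))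

lemma continuous_weight {l : ℝ} (hl : 0 ≤ l) : Continuous fun z : ℝ => (1 - z ^ 2) ^ l :=
  (Real.continuous_rpow_const hl).comp (by fun_prop)

lemma weight_nonneg (l : ℝ) {z : ℝ} (hz : z ∈ Icc (-1 : ℝ) 1) : 0 ≤ (1 - z ^ 2) ^ l :=
  Real.rpow_nonneg (by nlinarith [hz.1, hz.2]) _

lemma mom_intervalIntegrable {l : ℝ} (hl : 0 ≤ l) (k : ℕ) {f : ℝ → ℝ} (hf : Continuous f)
    (U r : ℝ) :
    IntervalIntegrable (fun z => (1 - z ^ 2) ^ l * (z ^ k * f (U + r * z))) volume (-1) 1 :=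
  ((continuous_weight hl).mul (by fun_prop)).intervalIntegrable _ _

/-- Differentiation is along a curve `(U(t), r(t))`, so that one statement serves velocity
derivatives, the rarefaction line `r = R - U` and the curves of constant mass flux. -/
lemma hasDerivAt_mom {l : ℝ} (hl : 0 ≤ l) (k : ℕ) {f f' : ℝ → ℝ}
    (hf : ∀ v, HasDerivAt f (f' v) v) (hf' : Continuous f') {s : Set ℝ} (hs : IsOpen s)
    {U U' r r' : ℝ → ℝ} (hU : ∀ t ∈ s, HasDerivAt U (U' t) t)
    (hr : ∀ t ∈ s, HasDerivAt r (r' t) t) (hU' : ContinuousOn U' s) (hr' : ContinuousOn r' s)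
    {t : ℝ} (ht : t ∈ s) :
    HasDerivAt (fun t => mom l k f (U t) (r t))
      (U' t * mom l k f' (U t) (r t) + r' t * mom l (k + 1) f' (U t) (r t)) t := by
  have hfc : Continuous f := continuous_iff_continuousAt.2 fun v => (hf v).continuousAt
  have hUc : ContinuousOn U s := fun t ht => (hU t ht).continuousAt.continuousWithinAt
  have hrc : ContinuousOn r s := fun t ht => (hr t ht).continuousAt.continuousWithinAt
  obtain ⟨ε, hε, hball⟩ := Metric.nhds_basis_closedBall.mem_iff.1 (hs.mem_nhds ht)
  set F' : ℝ → ℝ → ℝ := fun t z =>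
    (1 - z ^ 2) ^ l * (z ^ k * (f' (U t + r t * z) * (U' t + r' t * z))) with hF'
  have hF'c : ContinuousOn (Function.uncurry F') (s ×ˢ univ) := by
    have h1 : ∀ g : ℝ → ℝ, ContinuousOn g s →
        ContinuousOn (fun p : ℝ × ℝ => g p.1) (s ×ˢ (univ : Set ℝ)) := fun g hg =>
      hg.comp continuous_fst.continuousOn fun p hp => hp.1
    have hw : ContinuousOn (fun p : ℝ × ℝ => (1 - p.2 ^ 2) ^ l) (s ×ˢ (univ : Set ℝ)) :=
      ((continuous_weight hl).comp continuous_snd).continuousOn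
    have hz : ContinuousOn (fun p : ℝ × ℝ => p.2) (s ×ˢ (univ : Set ℝ)) :=
      continuous_snd.continuousOn
    refine hw.mul ((hz.pow k).mul (ContinuousOn.mul ?_ ?_))
    · exact hf'.comp_continuousOn ((h1 U hUc).add ((h1 r hrc).mul hz))
    · exact (h1 U' hU').add ((h1 r' hr').mul hz)
  obtain ⟨C, hC⟩ := ((isCompact_closedBall t ε).prod (isCompact_Icc (a := (-1 : ℝ)) (b := 1))
    ).exists_bound_of_continuousOn (hF'c.mono (prod_mono hball (subset_univ _)))
  have hcont : ∀ x ∈ s, Continuous (F' x) := fun x _ =>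
    (continuous_weight hl).mul (by fun_prop)
  have key := intervalIntegral.hasDerivAt_integral_of_dominated_loc_of_deriv_le
    (μ := volume) (a := -1) (b := 1) (bound := fun _ => C) (s := Metric.closedBall t ε)
    (F := fun x z => (1 - z ^ 2) ^ l * (z ^ k * f (U x + r x * z))) (F' := F') (x₀ := t)
    (Metric.closedBall_mem_nhds t hε)
    (Eventually.of_forall fun x =>
      ((continuous_weight hl).mul (by fun_prop)).aestronglyMeasurable)
    (mom_intervalIntegrable hl k hfc _ _) (hcont t ht).aestronglyMeasurable
    (Eventually.of_forall fun z hz x hx => by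
      rw [uIoc_of_le (by norm_num)] at hz
      exact hC (x, z) ⟨hx, hz.1.le, hz.2⟩)
    intervalIntegrable_const
    (Eventually.of_forall fun z _ x hx => by
      have hx' := hball hx
      have h := (hf (U x + r x * z)).comp x ((hU x hx').add ((hr x hx').mul_const z))
      exact (h.const_mul (z ^ k)).const_mul ((1 - z ^ 2) ^ l))
  suffices e : U' t * mom l k f' (U t) (r t) + r' t * mom l (k + 1) f' (U t) (r t)
      = ∫ z in (-1 : ℝ)..1, F' t z by
    rw [e]
    exact key.2
  rw [mom, mom, ← intervalIntegral.integral_const_mul, ← intervalIntegral.integral_const_mul,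
    ← intervalIntegral.integral_add]
  · exact intervalIntegral.integral_congr fun z _ => by ring
  · exact (mom_intervalIntegrable hl k hf' _ _).const_mul _
  · exact (mom_intervalIntegrable hl (k + 1) hf' _ _).const_mul _

/-- Integration by parts against the weight `(1 - z²)^l`. -/
lemma mom_one_eq {l : ℝ} (hl : 0 < l) {f f' : ℝ → ℝ}
    (hf : ∀ v, HasDerivAt f (f' v) v) (hf' : Continuous f') (U r : ℝ) :
    2 * (l + 1) * mom l 1 f U r = r * (mom l 0 f' U r - mom l 2 f' U r) := by
  have hd : ∀ z : ℝ, HasDerivAt (fun z : ℝ => (1 - z ^ 2) ^ (l + 1))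
      (-(2 * (l + 1)) * (z * (1 - z ^ 2) ^ l)) z := by
    intro z
    have h1 : HasDerivAt (fun z : ℝ => 1 - z ^ 2) (-(2 * z)) z := by
      simpa using ((hasDerivAt_id z).pow 2).const_sub 1
    have h2 := h1.rpow_const (p := l + 1) (Or.inr (by linarith))
    convert h2 using 1
    rw [add_sub_cancel_right]; ring
  have hg : ∀ z : ℝ, HasDerivAt (fun z => f (U + r * z)) (f' (U + r * z) * r) z := by
    intro z
    have h1 : HasDerivAt (fun z : ℝ => U + r * z) r z := by
      simpa using ((hasDerivAt_id z).const_mul r).const_add U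
    exact (hf _).comp z h1
  have hwc := continuous_weight hl.le
  have key := intervalIntegral.integral_mul_deriv_eq_deriv_mul (a := (-1 : ℝ)) (b := 1)
    (u := fun z : ℝ => (1 - z ^ 2) ^ (l + 1)) (v := fun z => f (U + r * z))
    (u' := fun z : ℝ => -(2 * (l + 1)) * (z * (1 - z ^ 2) ^ l))
    (v' := fun z => f' (U + r * z) * r)
    (fun z _ => hd z) (fun z _ => hg z)
    (Continuous.intervalIntegrable (by fun_prop) _ _)
    (Continuous.intervalIntegrable (by fun_prop) _ _)
  have h0 : (0 : ℝ) ^ (l + 1) = 0 := Real.zero_rpow (by linarith)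
  norm_num [h0] at key
  have e1 : (∫ z in (-1 : ℝ)..1, (1 - z ^ 2) ^ (l + 1) * (f' (U + r * z) * r))
      = r * (mom l 0 f' U r - mom l 2 f' U r) := by
    rw [mom, mom, ← intervalIntegral.integral_sub (mom_intervalIntegrable hl.le 0 hf' _ _)
      (mom_intervalIntegrable hl.le 2 hf' _ _), ← intervalIntegral.integral_const_mul]
    refine intervalIntegral.integral_congr fun z hz => ?_
    rw [uIcc_of_le (by norm_num)] at hz
    have h : (0 : ℝ) ≤ 1 - z ^ 2 := by nlinarith [hz.1, hz.2]
    rw [Real.rpow_add_one' h (by linarith)]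
    ring
  have e2 : (∫ z in (-1 : ℝ)..1, 2 * (l + 1) * (z * (1 - z ^ 2) ^ l) * f (U + r * z))
      = 2 * (l + 1) * mom l 1 f U r := by
    rw [mom, ← intervalIntegral.integral_const_mul]
    exact intervalIntegral.integral_congr fun z _ => by ring
  rw [e1, e2] at key
  exact key.symm

/-- The reflection `z ↦ -z`. -/
lemma mom_neg {l : ℝ} {k : ℕ} {f : ℝ → ℝ} (ε : ℝ) (hf : ∀ v, f (-v) = ε * f v) (U r : ℝ) :
    mom l k f (-U) r = (-1) ^ k * ε * mom l k f U r := by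
  rw [mom, mom, ← intervalIntegral.integral_const_mul]
  have := intervalIntegral.integral_comp_neg (a := (-1 : ℝ)) (b := 1)
    (fun z => (1 - z ^ 2) ^ l * (z ^ k * f (-U + r * z)))
  rw [neg_neg] at this
  rw [← this]
  refine intervalIntegral.integral_congr fun z _ => ?_
  rw [show -U + r * -z = -(U + r * z) by ring, hf, neg_sq, neg_pow z k]
  ring

lemma mom_zero_of_odd {l : ℝ} {k : ℕ} {f : ℝ → ℝ} {ε : ℝ} (hf : ∀ v, f (-v) = ε * f v)
    (hε : (-1) ^ k * ε = -1) (r : ℝ) : mom l k f 0 r = 0 := by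
  have := mom_neg (l := l) (k := k) ε hf 0 r
  rw [hε, neg_zero] at this
  linarith

/-! ### Smooth even convex functions -/

/-- `S` is even, convex and twice continuously differentiable, with derivatives `S₁`, `S₂`. -/
structure IsSmoothEvenConvex (S S₁ S₂ : ℝ → ℝ) : Prop where
  hasDeriv : ∀ v, HasDerivAt S (S₁ v) v
  hasDeriv₁ : ∀ v, HasDerivAt S₁ (S₂ v) v
  continuous₂ : Continuous S₂
  nonneg₂ : ∀ v, 0 ≤ S₂ v
  even : ∀ v, S (-v) = S v

namespace IsSmoothEvenConvex

variable {S S₁ S₂ : ℝ → ℝ}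

lemma continuous (h : IsSmoothEvenConvex S S₁ S₂) : Continuous S :=
  continuous_iff_continuousAt.2 fun v => (h.hasDeriv v).continuousAt

lemma continuous₁ (h : IsSmoothEvenConvex S S₁ S₂) : Continuous S₁ :=
  continuous_iff_continuousAt.2 fun v => (h.hasDeriv₁ v).continuousAt

lemma monotone₁ (h : IsSmoothEvenConvex S S₁ S₂) : Monotone S₁ :=
  monotone_of_hasDerivAt_nonneg h.hasDeriv₁ h.nonneg₂

lemma odd₁ (h : IsSmoothEvenConvex S S₁ S₂) (v : ℝ) : S₁ (-v) = -1 * S₁ v := by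
  have h1 : HasDerivAt (fun v => S (-v)) (S₁ (-v) * -1) v :=
    (h.hasDeriv (-v)).comp v (hasDerivAt_neg v)
  have h2 : (fun v => S (-v)) = S := funext h.even
  rw [h2] at h1
  have := h1.unique (h.hasDeriv v)
  linarith

lemma nonneg₁ (h : IsSmoothEvenConvex S S₁ S₂) {v : ℝ} (hv : 0 ≤ v) : 0 ≤ S₁ v := by
  have h1 := h.odd₁ 0
  have h2 := h.monotone₁ hv
  rw [neg_zero] at h1
  linarith

lemma monotoneOn (h : IsSmoothEvenConvex S S₁ S₂) : MonotoneOn S (Ici 0) := by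
  refine monotoneOn_of_deriv_nonneg (convex_Ici 0) h.continuous.continuousOn
    (fun v _ => (h.hasDeriv v).differentiableAt.differentiableWithinAt) fun v hv => ?_
  rw [(h.hasDeriv v).deriv]
  rw [interior_Ici] at hv
  exact h.nonneg₁ (le_of_lt hv)

lemma even_abs (h : IsSmoothEvenConvex S S₁ S₂) (v : ℝ) : S |v| = S v := by
  rcases abs_choice v with hv | hv <;> rw [hv]
  exact h.even v

/-- Integrals of the odd increasing function `S₁` against symmetric weights, centred at a
nonnegative point, are nonnegative. -/
lemma integral_weight_nonneg (h : IsSmoothEvenConvex S S₁ S₂) {p : ℝ → ℝ} (hp : ContinuousOn p (Icc (-1) 1))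
    (hp0 : ∀ z ∈ Icc (-1 : ℝ) 1, 0 ≤ p z) (hpe : ∀ z, p (-z) = p z) {U : ℝ} (hU : 0 ≤ U)
    (r : ℝ) : 0 ≤ ∫ z in (-1 : ℝ)..1, p z * S₁ (U + r * z) := by
  have hc := h.continuous₁
  have hle : (-1 : ℝ) ≤ 1 := by norm_num
  have i1 : IntervalIntegrable (fun z => p z * S₁ (U + r * z)) volume (-1) 1 := by
    apply ContinuousOn.intervalIntegrable
    rw [uIcc_of_le hle]
    exact hp.mul (by fun_prop)
  have i2 : IntervalIntegrable (fun z => p z * S₁ (U - r * z)) volume (-1) 1 := by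
    apply ContinuousOn.intervalIntegrable
    rw [uIcc_of_le hle]
    exact hp.mul (by fun_prop)
  have e : (∫ z in (-1 : ℝ)..1, p z * S₁ (U - r * z))
      = ∫ z in (-1 : ℝ)..1, p z * S₁ (U + r * z) := by
    have := intervalIntegral.integral_comp_neg (a := (-1 : ℝ)) (b := 1)
      (fun z => p z * S₁ (U + r * z))
    rw [neg_neg] at this
    rw [← this]
    refine intervalIntegral.integral_congr fun z _ => ?_
    simp only [hpe]
    congr 2; ring
  -- Symmetrizing in `z` pairs `S₁(U + r z)` with `S₁(U - r z) = -S₁(r z - U)`; monotonicity of `S₁`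
  -- and `U ≥ 0` make the sum nonnegative.
  have hsum : 0 ≤ ∫ z in (-1 : ℝ)..1, (p z * S₁ (U + r * z) + p z * S₁ (U - r * z)) := by
    refine intervalIntegral.integral_nonneg hle fun z hz => ?_
    rw [← mul_add]
    refine mul_nonneg (hp0 z hz) ?_
    have h1 := h.odd₁ (r * z - U)
    rw [neg_sub] at h1
    have h2 := h.monotone₁ (show r * z - U ≤ U + r * z by linarith)
    linarith
  rw [intervalIntegral.integral_add i1 i2, e] at hsum
  linarith

lemma mom_zero_nonneg (h : IsSmoothEvenConvex S S₁ S₂) {l : ℝ} (hl : 0 ≤ l) {U : ℝ} (hU : 0 ≤ U) (r : ℝ) :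
    0 ≤ mom l 0 S₁ U r := by
  have := h.integral_weight_nonneg (p := fun z => (1 - z ^ 2) ^ l)
    (continuous_weight hl).continuousOn (fun z hz => weight_nonneg l hz)
    (fun z => by simp only [neg_sq]) hU r
  simpa [mom] using this

/-- The function `r ↦ r ∫ (1 - z²)^l S₁(U + r z) dz` is nondecreasing: its derivative is
nonnegative. -/
lemma mom_zero_add_nonneg (h : IsSmoothEvenConvex S S₁ S₂) {l : ℝ} (hl : 0 < l) {U : ℝ} (hU : 0 ≤ U) (r : ℝ) :
    0 ≤ mom l 0 S₁ U r + r * mom l 1 S₂ U r := by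
  have hc1 := h.continuous₁
  have hc2 := h.continuous₂
  -- The second factor is the `z`-derivative of `z S₁(U + r z)`, which calls for integration by
  -- parts. For `l < 1` the derivative of `(1 - z²)^l` is singular at `±1`, so the weight is first
  -- enlarged by `ε` and then `ε → 0`.
  set g : ℝ → ℝ → ℝ := fun ε z =>
    (1 + ε - z ^ 2) ^ l * (S₁ (U + r * z) + z * (S₂ (U + r * z) * r)) with hg
  have hgc : Continuous (Function.uncurry g) := by
    refine Continuous.mul ?_ (by fun_prop)
    exact (Real.continuous_rpow_const hl.le).comp
      (show Continuous fun p : ℝ × ℝ => 1 + p.1 - p.2 ^ 2 by fun_prop)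
  have hlim : Tendsto (fun ε => ∫ z in (-1 : ℝ)..1, g ε z) (𝓝[>] 0)
      (𝓝 (∫ z in (-1 : ℝ)..1, g 0 z)) :=
    ((intervalIntegral.continuous_parametric_intervalIntegral_of_continuous' hgc _ _).tendsto
      0).mono_left nhdsWithin_le_nhds
  have e0 : (∫ z in (-1 : ℝ)..1, g 0 z) = mom l 0 S₁ U r + r * mom l 1 S₂ U r := by
    rw [mom, mom, ← intervalIntegral.integral_const_mul, ← intervalIntegral.integral_add
      (mom_intervalIntegrable hl.le 0 hc1 _ _)
      ((mom_intervalIntegrable hl.le 1 hc2 _ _).const_mul _)]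
    refine intervalIntegral.integral_congr fun z _ => ?_
    simp only [hg, add_zero]; ring
  rw [← e0]
  refine ge_of_tendsto hlim ?_
  filter_upwards [self_mem_nhdsWithin] with ε hε
  have hε : 0 < ε := hε
  have hle : (-1 : ℝ) ≤ 1 := by norm_num
  have hpos : ∀ z ∈ Icc (-1 : ℝ) 1, 0 < 1 + ε - z ^ 2 := fun z hz => by
    nlinarith [hz.1, hz.2]
  have hpc : ∀ m : ℝ, ContinuousOn (fun z : ℝ => (1 + ε - z ^ 2) ^ m) (Icc (-1) 1) := fun m =>
    ContinuousOn.rpow_const (by fun_prop) fun z hz => Or.inl (hpos z hz).ne'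
  have hd : ∀ z ∈ Icc (-1 : ℝ) 1, HasDerivAt (fun z : ℝ => (1 + ε - z ^ 2) ^ l)
      (-(2 * z) * l * (1 + ε - z ^ 2) ^ (l - 1)) z := by
    intro z hz
    have h1 : HasDerivAt (fun z : ℝ => 1 + ε - z ^ 2) (-(2 * z)) z := by
      simpa using ((hasDerivAt_id z).pow 2).const_sub (1 + ε)
    exact h1.rpow_const (Or.inl (hpos z hz).ne')
  have hv : ∀ z : ℝ, HasDerivAt (fun z => z * S₁ (U + r * z))
      (S₁ (U + r * z) + z * (S₂ (U + r * z) * r)) z := by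
    intro z
    have h1 : HasDerivAt (fun z : ℝ => U + r * z) r z := by
      simpa using ((hasDerivAt_id z).const_mul r).const_add U
    have h2 := (hasDerivAt_id z).mul ((h.hasDeriv₁ _).comp z h1)
    rw [one_mul] at h2
    exact h2
  have key := intervalIntegral.integral_mul_deriv_eq_deriv_mul (a := (-1 : ℝ)) (b := 1)
    (u := fun z : ℝ => (1 + ε - z ^ 2) ^ l) (v := fun z => z * S₁ (U + r * z))
    (u' := fun z : ℝ => -(2 * z) * l * (1 + ε - z ^ 2) ^ (l - 1))
    (v' := fun z => S₁ (U + r * z) + z * (S₂ (U + r * z) * r))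
    (fun z hz => hd z (by rwa [uIcc_of_le hle] at hz)) (fun z _ => hv z)
    (by
      apply ContinuousOn.intervalIntegrable
      rw [uIcc_of_le hle]
      exact ContinuousOn.mul (by fun_prop) (hpc _))
    (Continuous.intervalIntegrable (by fun_prop) _ _)
  have hw := h.integral_weight_nonneg
    (p := fun z => 2 * l * z ^ 2 * (1 + ε - z ^ 2) ^ (l - 1))
    (ContinuousOn.mul (by fun_prop) (hpc _))
    (fun z hz => mul_nonneg (by positivity) (Real.rpow_nonneg (hpos z hz).le _))
    (fun z => by simp only [neg_sq]) hU r
  have e1 : (∫ z in (-1 : ℝ)..1, -(2 * z) * l * (1 + ε - z ^ 2) ^ (l - 1)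
      * (z * S₁ (U + r * z)))
      = -∫ z in (-1 : ℝ)..1, 2 * l * z ^ 2 * (1 + ε - z ^ 2) ^ (l - 1) * S₁ (U + r * z) := by
    rw [← intervalIntegral.integral_neg]
    exact intervalIntegral.integral_congr fun z _ => by ring
  have hb : 0 ≤ S₁ (U + r) + S₁ (U - r) := by
    have h1 := h.odd₁ (r - U)
    rw [neg_sub] at h1
    have h2 := h.monotone₁ (show r - U ≤ U + r by linarith)
    linarith
  have hx : (0 : ℝ) ≤ (1 + ε - 1) ^ l := Real.rpow_nonneg (by linarith) _
  simp only [hg]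
  rw [key, e1]
  have e2 : U + r * -1 = U - r := by ring
  simp only [one_pow, neg_sq, mul_one, one_mul, e2]
  nlinarith [mul_nonneg hx hb]

end IsSmoothEvenConvex

/-! ### The entropy flux as a function of velocity and sound speed -/

/-- The entropy flux of a state with velocity `U` and `a ρ^θ = r`, up to the factor `ρ / J`. -/
noncomputable def fluxMom (l θ : ℝ) (S : ℝ → ℝ) (U r : ℝ) : ℝ :=
  U * mom l 0 S U r + θ * r * mom l 1 S U r

/-- The derivative of `fluxMom` in `U`. -/
noncomputable def fluxMomU (l θ : ℝ) (S S₁ : ℝ → ℝ) (U r : ℝ) : ℝ :=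
  mom l 0 S U r + U * mom l 0 S₁ U r + θ * r * mom l 1 S₁ U r

/-- The derivative of `fluxMom` in `r`. -/
noncomputable def fluxMomR (l θ : ℝ) (S S₁ : ℝ → ℝ) (U r : ℝ) : ℝ :=
  U * mom l 1 S₁ U r + θ * mom l 1 S U r + θ * r * mom l 2 S₁ U r

/-- Since `θ (2 l + 1) = 1`, the factor `2 (l + 1)` from integration by parts becomes `(1 + θ) / θ`.
This is where the exponent of the kernel is tied to `γ`. -/
lemma mom_one_eq_theta {l θ : ℝ} (hl : 0 < l) (hθl : θ * (2 * l + 1) = 1) {f f' : ℝ → ℝ}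
    (hf : ∀ v, HasDerivAt f (f' v) v) (hf' : Continuous f') (U r : ℝ) :
    (1 + θ) * mom l 1 f U r = θ * (r * (mom l 0 f' U r - mom l 2 f' U r)) := by
  rw [← mom_one_eq hl hf hf' U r]
  linear_combination (-mom l 1 f U r) * hθl

lemma mom_sub_mom_nonneg {l : ℝ} (hl : 0 ≤ l) {f : ℝ → ℝ} (hf : Continuous f)
    (hf0 : ∀ v, 0 ≤ f v) (U r : ℝ) : 0 ≤ mom l 0 f U r - mom l 1 f U r := by
  rw [mom, mom, ← intervalIntegral.integral_sub (mom_intervalIntegrable hl 0 hf _ _)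
    (mom_intervalIntegrable hl 1 hf _ _)]
  refine intervalIntegral.integral_nonneg (by norm_num) fun z hz => ?_
  rw [← mul_sub]
  refine mul_nonneg (weight_nonneg l hz) ?_
  nlinarith [mul_nonneg (sub_nonneg.2 hz.2) (hf0 (U + r * z))]

lemma mom_zero_nonneg_of_nonneg {l : ℝ} {f : ℝ → ℝ} (hf0 : ∀ v, 0 ≤ f v) (U r : ℝ) :
    0 ≤ mom l 0 f U r := by
  refine intervalIntegral.integral_nonneg (by norm_num) fun z hz => ?_
  rw [pow_zero, one_mul]
  exact mul_nonneg (weight_nonneg l hz) (hf0 _)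

namespace IsSmoothEvenConvex

variable {S S₁ S₂ : ℝ → ℝ} {l θ : ℝ}

lemma hasDerivAt_fluxMom (h : IsSmoothEvenConvex S S₁ S₂) (hl : 0 < l)
    {s : Set ℝ} (hs : IsOpen s)
    {U U' r r' : ℝ → ℝ} (hU : ∀ t ∈ s, HasDerivAt U (U' t) t)
    (hr : ∀ t ∈ s, HasDerivAt r (r' t) t) (hU' : ContinuousOn U' s) (hr' : ContinuousOn r' s)
    {t : ℝ} (ht : t ∈ s) :
    HasDerivAt (fun t => fluxMom l θ S (U t) (r t))
      (U' t * fluxMomU l θ S S₁ (U t) (r t) + r' t * fluxMomR l θ S S₁ (U t) (r t)) t := by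
  have h0 := hasDerivAt_mom hl.le 0 h.hasDeriv h.continuous₁ hs hU hr hU' hr' ht
  have h1 := hasDerivAt_mom hl.le 1 h.hasDeriv h.continuous₁ hs hU hr hU' hr' ht
  have := ((hU t ht).mul h0).add ((((hr t ht).const_mul θ)).mul h1)
  refine this.congr_deriv ?_
  rw [fluxMomU, fluxMomR]
  ring

lemma hasDerivAt_mom_velocity {f f' : ℝ → ℝ} (hl : 0 < l) (k : ℕ)
    (hf : ∀ v, HasDerivAt f (f' v) v) (hf' : Continuous f') (U r : ℝ) :
    HasDerivAt (fun U => mom l k f U r) (mom l k f' U r) U := by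
  have := hasDerivAt_mom hl.le k hf hf' isOpen_univ (U := fun t => t) (U' := fun _ => 1)
    (r := fun _ => r) (r' := fun _ => 0) (fun t _ => hasDerivAt_id t)
    (fun t _ => hasDerivAt_const t r) continuousOn_const continuousOn_const (mem_univ U)
  simpa using this

lemma hasDerivAt_fluxMom_velocity (h : IsSmoothEvenConvex S S₁ S₂) (hl : 0 < l) (U r : ℝ) :
    HasDerivAt (fun U => fluxMom l θ S U r) (fluxMomU l θ S S₁ U r) U := by
  have := h.hasDerivAt_fluxMom hl isOpen_univ (θ := θ) (U := fun t => t) (U' := fun _ => 1)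
    (r := fun _ => r) (r' := fun _ => 0) (fun t _ => hasDerivAt_id t)
    (fun t _ => hasDerivAt_const t r) continuousOn_const continuousOn_const (mem_univ U)
  simpa using this

lemma fluxMom_neg (h : IsSmoothEvenConvex S S₁ S₂) (U r : ℝ) :
    fluxMom l θ S (-U) r = -fluxMom l θ S U r := by
  have he : ∀ v, S (-v) = 1 * S v := fun v => by rw [one_mul]; exact h.even v
  rw [fluxMom, fluxMom, mom_neg 1 he, mom_neg 1 he]
  ring

lemma fluxMom_zero (h : IsSmoothEvenConvex S S₁ S₂) (r : ℝ) : fluxMom l θ S 0 r = 0 := by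
  have := h.fluxMom_neg (l := l) (θ := θ) 0 r
  rw [neg_zero] at this
  linarith

lemma fluxMomR_zero (h : IsSmoothEvenConvex S S₁ S₂) (r : ℝ) :
    fluxMomR l θ S S₁ 0 r = 0 := by
  have he : ∀ v, S (-v) = 1 * S v := fun v => by rw [one_mul]; exact h.even v
  rw [fluxMomR, mom_zero_of_odd (k := 1) he (by norm_num),
    mom_zero_of_odd (k := 2) h.odd₁ (by norm_num)]
  ring

/-- For fixed density the entropy flux is a convex function of the velocity `U ≥ 0`. -/
lemma convexOn_fluxMom (h : IsSmoothEvenConvex S S₁ S₂) (hl : 0 < l) (hθ : 0 < θ)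
    (hθ1 : θ < 1) (r : ℝ) : ConvexOn ℝ (Ici 0) fun U => fluxMom l θ S U r := by
  have hd : ∀ U, HasDerivAt (fun U => fluxMomU l θ S S₁ U r)
      (2 * mom l 0 S₁ U r + U * mom l 0 S₂ U r + θ * r * mom l 1 S₂ U r) U := by
    intro U
    have := ((hasDerivAt_mom_velocity hl 0 h.hasDeriv h.continuous₁ U r).add
      ((hasDerivAt_id U).mul
        (hasDerivAt_mom_velocity hl 0 h.hasDeriv₁ h.continuous₂ U r))).add
      ((hasDerivAt_mom_velocity hl 1 h.hasDeriv₁ h.continuous₂ U r).const_mul (θ * r))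
    refine this.congr_deriv ?_
    simp only [id]
    ring
  have hdiff : ∀ U, HasDerivAt (fun U => fluxMom l θ S U r) (fluxMomU l θ S S₁ U r) U :=
    fun U => h.hasDerivAt_fluxMom_velocity hl U r
  have hderiv : deriv (fun U => fluxMom l θ S U r) = fun U => fluxMomU l θ S S₁ U r :=
    funext fun U => (hdiff U).deriv
  refine convexOn_of_deriv2_nonneg (convex_Ici 0)
    (fun U _ => (hdiff U).continuousAt.continuousWithinAt)
    (fun U _ => (hdiff U).differentiableAt.differentiableWithinAt) ?_ ?_
  · rw [hderiv]
    exact fun U _ => (hd U).differentiableAt.differentiableWithinAt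
  · intro U hU
    rw [interior_Ici] at hU
    have hU : 0 < U := hU
    rw [Function.iterate_succ, Function.iterate_one, Function.comp_apply, hderiv, (hd U).deriv]
    -- The second derivative splits as `(2 - θ) n₀ + U m₀ + θ (n₀ + r m₁)`, where `n₀` is a moment
    -- of `S₁` and `m₀`, `m₁` are moments of `S₂`; all three terms are nonnegative.
    have h1 := h.mom_zero_nonneg hl.le hU.le r
    have h2 := h.mom_zero_add_nonneg hl hU.le r
    have h3 := mom_zero_nonneg_of_nonneg (l := l) h.nonneg₂ U r
    nlinarith [mul_nonneg hU.le h3, mul_nonneg hθ.le h2, mul_nonneg (sub_nonneg.2 hθ1.le) h1]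

/-- Chords from the origin of a convex function vanishing at `0` have increasing slopes. -/
lemma fluxMom_div_mono (h : IsSmoothEvenConvex S S₁ S₂) (hl : 0 < l) (hθ : 0 < θ)
    (hθ1 : θ < 1) {U V : ℝ} (r : ℝ) (hU : 0 < U) (hUV : U ≤ V) :
    fluxMom l θ S U r / U ≤ fluxMom l θ S V r / V := by
  have hV : 0 < V := hU.trans_le hUV
  have hc := (h.convexOn_fluxMom hl hθ hθ1 r).2 (mem_Ici.2 hV.le) (mem_Ici.2 le_rfl)
    (show 0 ≤ U / V by positivity) (sub_nonneg.2 ((div_le_one hV).2 hUV)) (by ring)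
  simp only [smul_eq_mul, mul_zero, add_zero, h.fluxMom_zero, div_mul_cancel₀ _ hV.ne'] at hc
  rw [div_le_div_iff₀ hU hV]
  calc fluxMom l θ S U r * V ≤ U / V * fluxMom l θ S V r * V := by gcongr
    _ = fluxMom l θ S V r * U := by field_simp

lemma mul_fluxMomU_zero_le (h : IsSmoothEvenConvex S S₁ S₂) (hl : 0 < l) (hθ : 0 < θ)
    (hθ1 : θ < 1) {U : ℝ} (r : ℝ) (hU : 0 < U) :
    U * fluxMomU l θ S S₁ 0 r ≤ fluxMom l θ S U r := by
  have h1 := (h.convexOn_fluxMom hl hθ hθ1 r).le_slope_of_hasDerivAt (mem_Ici.2 le_rfl)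
    (mem_Ici.2 hU.le) hU (h.hasDerivAt_fluxMom_velocity hl 0 r)
  rw [slope_def_field, h.fluxMom_zero, sub_zero, sub_zero, le_div_iff₀ hU] at h1
  linarith

/-- At `U = 0` only the integrals of `S(r z)` and of `θ r z S₁(r z)` remain. Both integrands are
even in `z` and nondecreasing in `r ≥ 0`, because `S` and `y S₁(y)` increase with `|y|`. -/
lemma fluxMomU_zero_mono (h : IsSmoothEvenConvex S S₁ S₂) (hl : 0 < l) (hθ : 0 < θ)
    {r R : ℝ} (hr : 0 ≤ r) (hrR : r ≤ R) :
    fluxMomU l θ S S₁ 0 r ≤ fluxMomU l θ S S₁ 0 R := by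
  have hR : 0 ≤ R := hr.trans hrR
  have h0 : mom l 0 S 0 r ≤ mom l 0 S 0 R := by
    refine intervalIntegral.integral_mono_on (by norm_num)
      (mom_intervalIntegrable hl.le 0 h.continuous _ _)
      (mom_intervalIntegrable hl.le 0 h.continuous _ _) fun z hz => ?_
    refine mul_le_mul_of_nonneg_left ?_ (weight_nonneg l hz)
    simp only [pow_zero, one_mul, zero_add]
    rw [← h.even_abs (r * z), ← h.even_abs (R * z)]
    refine h.monotoneOn (mem_Ici.2 (abs_nonneg _)) (mem_Ici.2 (abs_nonneg _)) ?_
    rw [abs_mul, abs_mul, abs_of_nonneg hr, abs_of_nonneg hR]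
    gcongr
  have h1 : r * mom l 1 S₁ 0 r ≤ R * mom l 1 S₁ 0 R := by
    rw [mom, mom, ← intervalIntegral.integral_const_mul, ← intervalIntegral.integral_const_mul]
    refine intervalIntegral.integral_mono_on (by norm_num)
      ((mom_intervalIntegrable hl.le 1 h.continuous₁ _ _).const_mul _)
      ((mom_intervalIntegrable hl.le 1 h.continuous₁ _ _).const_mul _) fun z hz => ?_
    simp only [pow_one, zero_add]
    have key : r * (z * S₁ (r * z)) ≤ R * (z * S₁ (R * z)) := by
      have hpos : ∀ y : ℝ, 0 ≤ y → r * (y * S₁ (r * y)) ≤ R * (y * S₁ (R * y)) := by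
        intro y hy
        have h1 : r * y ≤ R * y := by gcongr
        have h2 := h.monotone₁ h1
        have h3 := h.nonneg₁ (mul_nonneg hr hy)
        calc r * (y * S₁ (r * y)) = (r * y) * S₁ (r * y) := by ring
          _ ≤ (R * y) * S₁ (R * y) := mul_le_mul h1 h2 h3 (mul_nonneg hR hy)
          _ = R * (y * S₁ (R * y)) := by ring
      rcases le_total 0 z with hz0 | hz0
      · exact hpos z hz0
      · have := hpos (-z) (neg_nonneg.2 hz0)
        rw [mul_neg r z, mul_neg R z, h.odd₁, h.odd₁] at this
        nlinarith
    calc r * ((1 - z ^ 2) ^ l * (z * S₁ (r * z)))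
        = (1 - z ^ 2) ^ l * (r * (z * S₁ (r * z))) := by ring
      _ ≤ (1 - z ^ 2) ^ l * (R * (z * S₁ (R * z))) :=
          mul_le_mul_of_nonneg_left key (weight_nonneg l hz)
      _ = _ := by ring
  rw [fluxMomU, fluxMomU]
  nlinarith [mul_le_mul_of_nonneg_left h1 hθ.le]

/-- Bound for states moving towards the junction with density at least the one there. -/
lemma mul_fluxMomU_le_of_le (h : IsSmoothEvenConvex S S₁ S₂) (hl : 0 < l) (hθ : 0 < θ)
    (hθ1 : θ < 1) {U r R : ℝ} (hU : 0 < U) (hR : 0 ≤ R) (hRr : R ≤ r) :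
    U * fluxMomU l θ S S₁ 0 R ≤ fluxMom l θ S U r :=
  (mul_le_mul_of_nonneg_left (h.fluxMomU_zero_mono hl hθ hR hRr) hU.le).trans
    (h.mul_fluxMomU_zero_le hl hθ hθ1 r hU)

/-- The nonnegative factor in the derivative of the flux along rarefaction curves. -/
lemma rarefaction_factor_nonneg (h : IsSmoothEvenConvex S S₁ S₂) (hl : 0 < l) (hθ : 0 < θ)
    (hθl : θ * (2 * l + 1) = 1) {U : ℝ} (hU : 0 ≤ U) (r : ℝ) :
    0 ≤ θ * r * (mom l 0 S₁ U r - mom l 2 S₁ U r)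
      + (1 + θ) * U * (mom l 0 S₁ U r - mom l 1 S₁ U r) := by
  set M : ℝ → ℝ := fun U => θ * r * (mom l 0 S₁ U r - mom l 2 S₁ U r)
      + (1 + θ) * U * (mom l 0 S₁ U r - mom l 1 S₁ U r) with hM
  have hd : ∀ V, HasDerivAt M ((1 + θ) * (mom l 0 S₁ V r
      + V * (mom l 0 S₂ V r - mom l 1 S₂ V r))) V := by
    intro V
    have d := fun k => hasDerivAt_mom_velocity hl k h.hasDeriv₁ h.continuous₂ V r
    have := (((d 0).sub (d 2)).const_mul (θ * r)).add
      (((hasDerivAt_id V).const_mul (1 + θ)).mul ((d 0).sub (d 1)))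
    refine this.congr_deriv ?_
    -- Integration by parts turns the derivative of the first summand into `(1 + θ)` times the first
    -- moment of `S₁`, which cancels the one from the second summand.
    have hp := mom_one_eq_theta hl hθl h.hasDeriv₁ h.continuous₂ V r
    simp only [id, Pi.sub_apply]
    linear_combination -hp
  have hmono : MonotoneOn M (Ici 0) := by
    refine monotoneOn_of_deriv_nonneg (convex_Ici 0)
      (fun V _ => (hd V).continuousAt.continuousWithinAt)
      (fun V _ => (hd V).differentiableAt.differentiableWithinAt) fun V hV => ?_
    rw [interior_Ici] at hV
    have hV : 0 < V := hV
    rw [(hd V).deriv]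
    have h1 := h.mom_zero_nonneg hl.le hV.le r
    have h2 := mom_sub_mom_nonneg hl.le h.continuous₂ h.nonneg₂ V r
    positivity
  have h0 : M 0 = 0 := by
    simp only [hM]
    rw [mom_zero_of_odd h.odd₁ (by norm_num), mom_zero_of_odd (k := 2) h.odd₁ (by norm_num)]
    ring
  have := hmono (mem_Ici.2 le_rfl) (mem_Ici.2 hU) hU
  rwa [h0] at this

/-- The left side is `U²` times the derivative of `V ↦ H(V, R - V) / V` at `V = U`, with `R = U +
r`. Its sign is that of the first eigenvalue `U - θ r`, since the other factor is nonnegative for `U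
≥ 0`. -/
lemma fluxMom_rarefaction_deriv (h : IsSmoothEvenConvex S S₁ S₂) (hl : 0 < l) (hθ : 0 < θ)
    (hθl : θ * (2 * l + 1) = 1) (U r : ℝ) :
    U * (fluxMomU l θ S S₁ U r - fluxMomR l θ S S₁ U r) - fluxMom l θ S U r
      = (U - θ * r) / (1 + θ) * (θ * r * (mom l 0 S₁ U r - mom l 2 S₁ U r)
      + (1 + θ) * U * (mom l 0 S₁ U r - mom l 1 S₁ U r)) := by
  have hp := mom_one_eq_theta hl hθl h.hasDeriv h.continuous₁ U r
  have h1 : (1 : ℝ) + θ ≠ 0 := by positivity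
  rw [fluxMomU, fluxMomR, fluxMom]
  field_simp
  linear_combination (-θ * (U + r)) * hp

/-- Bound along the subsonic part of a rarefaction curve. -/
lemma fluxMom_le_of_rarefaction (h : IsSmoothEvenConvex S S₁ S₂) (hl : 0 < l) (hθ : 0 < θ)
    (hθl : θ * (2 * l + 1) = 1) {U r : ℝ} (hU : 0 < U) (hUr : U ≤ θ * r) :
    fluxMom l θ S U r ≤ U * fluxMomU l θ S S₁ 0 (U + r) := by
  set R := U + r with hR
  have hd : ∀ V, HasDerivAt (fun V => fluxMom l θ S V (R - V))
      (fluxMomU l θ S S₁ V (R - V) - fluxMomR l θ S S₁ V (R - V)) V := by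
    intro V
    have := h.hasDerivAt_fluxMom hl isOpen_univ (θ := θ) (U := fun t => t) (U' := fun _ => 1)
      (r := fun t => R - t) (r' := fun _ => -1) (fun t _ => hasDerivAt_id t)
      (fun t _ => by simpa using (hasDerivAt_id t).const_sub R)
      continuousOn_const continuousOn_const (mem_univ V)
    refine this.congr_deriv ?_
    ring
  have hanti : AntitoneOn (fun V => fluxMom l θ S V (R - V) / V) (Ioc 0 U) := by
    have hq : ∀ V ∈ Ioc (0 : ℝ) U, HasDerivAt (fun V => fluxMom l θ S V (R - V) / V)
        (((fluxMomU l θ S S₁ V (R - V) - fluxMomR l θ S S₁ V (R - V)) * V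
          - fluxMom l θ S V (R - V) * 1) / V ^ 2) V := fun V hV =>
      (hd V).div (hasDerivAt_id V) hV.1.ne'
    refine antitoneOn_of_deriv_nonpos (convex_Ioc 0 U)
      (fun V hV => (hq V hV).continuousAt.continuousWithinAt)
      (fun V hV => (hq V (interior_subset hV)).differentiableAt.differentiableWithinAt) ?_
    intro V hV
    have hV' := interior_subset hV
    rw [(hq V hV').deriv]
    refine div_nonpos_of_nonpos_of_nonneg ?_ (by positivity)
    have e := h.fluxMom_rarefaction_deriv hl hθ hθl V (R - V)
    have hf := h.rarefaction_factor_nonneg hl hθ hθl hV'.1.le (R - V)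
    have hn : (V - θ * (R - V)) / (1 + θ) ≤ 0 := by
      refine div_nonpos_of_nonpos_of_nonneg ?_ (by positivity)
      have : θ * r ≤ θ * (R - V) := by
        refine mul_le_mul_of_nonneg_left ?_ hθ.le
        linarith [hV'.2]
      linarith [hV'.2]
    have := mul_nonpos_of_nonpos_of_nonneg hn hf
    linarith
  -- As `H(0, ·) = 0`, the quotient is a difference quotient at `0`; its limit loses the
  -- `r`-derivative, which vanishes at `U = 0` by parity.
  have hlim : Tendsto (fun V => fluxMom l θ S V (R - V) / V) (𝓝[>] 0)
      (𝓝 (fluxMomU l θ S S₁ 0 R)) := by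
    have h0 := hasDerivAt_iff_tendsto_slope.1 (hd 0)
    rw [sub_zero, h.fluxMomR_zero, sub_zero] at h0
    refine (h0.mono_left (nhdsWithin_mono 0 fun x hx => ne_of_gt hx)).congr fun V => ?_
    rw [slope_def_field, h.fluxMom_zero, sub_zero, sub_zero]
  have hle : fluxMom l θ S U (R - U) / U ≤ fluxMomU l θ S S₁ 0 R := by
    refine ge_of_tendsto hlim ?_
    filter_upwards [Ioc_mem_nhdsGT hU] with V hV
    exact hanti hV ⟨hU, le_rfl⟩ hV.2
  rw [div_le_iff₀ hU, hR, add_sub_cancel_left] at hle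
  linarith

end IsSmoothEvenConvex

/-! ### Stationary shocks -/

/-- Shock curves are steeper than rarefaction curves. -/
lemma rarefaction_jump_sq_le {κ γ θ a : ℝ} (hκ : 0 < κ) (hθ : 0 < θ) (hγ : γ = 2 * θ + 1)
    (haκ : (a * θ) ^ 2 = κ * γ) {x y : ℝ} (hx : 0 < x) (hxy : x < y) :
    (a * (y ^ θ - x ^ θ)) ^ 2 ≤ κ * (y ^ γ - x ^ γ) * (1 / x - 1 / y) := by
  have hy : 0 < y := hx.trans hxy
  have hγ0 : 0 < γ := by linarith
  set X := (y ^ γ - x ^ γ) / γ with hX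
  set Y := 1 / x - 1 / y with hY
  set Z := (y ^ θ - x ^ θ) / θ with hZ
  have hXpos : 0 < X := div_pos (sub_pos.2 (Real.rpow_lt_rpow hx.le hxy hγ0)) hγ0
  have hYpos : 0 < Y := sub_pos.2 (one_div_lt_one_div_of_lt hx hxy)
  have hZpos : 0 < Z := div_pos (sub_pos.2 (Real.rpow_lt_rpow hx.le hxy hθ)) hθ
  -- Cauchy–Schwarz on `[x, y]` for `s^θ` and `1/s`: `X`, `Y`, `Z` are the integrals of `s^(2θ)`,
  -- `s⁻²`, `s^(θ-1)`, and the quadratic in `t` is the integral of `(t s^θ - 1/s)²`, with primitive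
  -- `f`.
  have key : ∀ t : ℝ, 0 ≤ t ^ 2 * X - 2 * t * Z + Y := by
    intro t
    set f : ℝ → ℝ := fun s => t ^ 2 * (s ^ γ / γ) - 2 * t * (s ^ θ / θ) - s⁻¹ with hf
    have hd : ∀ s ∈ Ioi (0 : ℝ), HasDerivAt f ((t * s ^ θ - s⁻¹) ^ 2) s := by
      intro s hs
      have hs : 0 < s := hs
      have d1 := ((Real.hasDerivAt_rpow_const (p := γ) (Or.inl hs.ne')).div_const γ).const_mul
        (t ^ 2)
      have d2 := ((Real.hasDerivAt_rpow_const (p := θ) (Or.inl hs.ne')).div_const θ).const_mul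
        (2 * t)
      have := (d1.sub d2).sub (hasDerivAt_inv hs.ne')
      refine this.congr_deriv ?_
      have e1 : s ^ (γ - 1) = s ^ θ * s ^ θ := by
        rw [← Real.rpow_add hs]; congr 1; rw [hγ]; ring
      have e2 : s ^ (θ - 1) = s ^ θ * s⁻¹ := by
        rw [Real.rpow_sub_one hs.ne', div_eq_mul_inv]
      rw [e1, e2]
      field_simp
      ring
    have hmono : MonotoneOn f (Ioi 0) := by
      refine monotoneOn_of_deriv_nonneg (convex_Ioi 0)
        (fun s hs => (hd s hs).continuousAt.continuousWithinAt)
        (fun s hs => (hd s (interior_subset hs)).differentiableAt.differentiableWithinAt)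
        fun s hs => ?_
      rw [(hd s (interior_subset hs)).deriv]
      positivity
    have := hmono (mem_Ioi.2 hx) (mem_Ioi.2 hy) hxy.le
    simp only [hf] at this
    rw [hX, hY, hZ, one_div, one_div]
    have e : t ^ 2 * ((y ^ γ - x ^ γ) / γ) - 2 * t * ((y ^ θ - x ^ θ) / θ) + (x⁻¹ - y⁻¹)
        = (t ^ 2 * (y ^ γ / γ) - 2 * t * (y ^ θ / θ) - y⁻¹)
          - (t ^ 2 * (x ^ γ / γ) - 2 * t * (x ^ θ / θ) - x⁻¹) := by ring
    rw [e]
    linarith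
  have hZX : Z ^ 2 ≤ X * Y := by
    -- The minimizer of the quadratic.
    have h := key (Z / X)
    have e : (Z / X) ^ 2 * X - 2 * (Z / X) * Z + Y = (X * Y - Z ^ 2) / X := by
      field_simp; ring
    rw [e] at h
    have := (div_nonneg_iff.1 h).resolve_right (fun h' => absurd h'.2 (not_le.2 hXpos))
    linarith [this.1]
  have e1 : (a * (y ^ θ - x ^ θ)) ^ 2 = κ * γ * Z ^ 2 := by
    rw [← haκ, hZ]; field_simp
  have e2 : κ * (y ^ γ - x ^ γ) * Y = κ * γ * (X * Y) := by
    rw [hX]; field_simp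
  rw [e1, e2]
  gcongr

/-- The value of `j² / (κ ρ₂^(γ+1))` across a stationary shock with mass flux `j` between the
densities `ρ₁ = ζ ρ₂` and `ρ₂`. -/
noncomputable def shockRatio (γ ζ : ℝ) : ℝ := ζ * ((1 - ζ ^ γ) / (1 - ζ))

/-- The density behind the stationary shock with mass flux `j` and density ratio `ζ`. -/
noncomputable def shockDensity (κ γ j ζ : ℝ) : ℝ :=
  (j ^ 2 / (κ * shockRatio γ ζ)) ^ (1 / (γ + 1))

lemma shockRatio_pos {γ ζ : ℝ} (hγ : 0 < γ) (h0 : 0 < ζ) (h1 : ζ < 1) :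
    0 < shockRatio γ ζ :=
  mul_pos h0 (div_pos (sub_pos.2 (Real.rpow_lt_one h0.le h1 hγ)) (sub_pos.2 h1))

lemma shockRatio_mono {γ : ℝ} (hγ : 1 < γ) : MonotoneOn (shockRatio γ) (Ioo 0 1) := by
  intro x hx y hy hxy
  rcases hxy.eq_or_lt with rfl | hxy
  · exact le_rfl
  refine mul_le_mul hxy.le ?_ (div_nonneg ?_ (sub_nonneg.2 hx.2.le)) hy.1.le
  · have hc := (convexOn_rpow hγ.le).secant_mono (a := 1) (mem_Ici.2 zero_le_one)
      (mem_Ici.2 hx.1.le) (mem_Ici.2 hy.1.le) hx.2.ne hy.2.ne hxy.le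
    rw [Real.one_rpow] at hc
    rw [← neg_sub (x ^ γ) 1, ← neg_sub x 1, ← neg_sub (y ^ γ) 1, ← neg_sub y 1, neg_div_neg_eq,
      neg_div_neg_eq]
    exact hc
  · exact sub_nonneg.2 (Real.rpow_le_one hx.1.le hx.2.le (by linarith))

/-- Bernoulli's inequality. The value `γ` is the sonic one, since `j² = κ γ ρ^(γ+1)` at sound speed,
so the denser side of a stationary shock is not supersonic. -/
lemma shockRatio_le {γ ζ : ℝ} (hγ : 1 < γ) (h0 : 0 < ζ) (h1 : ζ < 1) : shockRatio γ ζ ≤ γ := by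
  have hb := one_add_mul_self_le_rpow_one_add (s := ζ - 1) (by linarith) hγ.le
  rw [add_sub_cancel] at hb
  have h2 : (1 - ζ ^ γ) / (1 - ζ) ≤ γ := by
    rw [div_le_iff₀ (sub_pos.2 h1)]; linarith
  have h3 : 0 ≤ (1 - ζ ^ γ) / (1 - ζ) :=
    div_nonneg (sub_nonneg.2 (Real.rpow_le_one h0.le h1.le (by linarith))) (sub_nonneg.2 h1.le)
  calc shockRatio γ ζ ≤ 1 * ((1 - ζ ^ γ) / (1 - ζ)) := mul_le_mul_of_nonneg_right h1.le h3
    _ ≤ γ := by rw [one_mul]; exact h2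

lemma shockRatio_tendsto {γ : ℝ} : Tendsto (shockRatio γ) (𝓝[<] 1) (𝓝 γ) := by
  have hd := Real.hasDerivAt_rpow_const (x := 1) (p := γ) (Or.inl one_ne_zero)
  rw [Real.one_rpow, mul_one, hasDerivAt_iff_tendsto_slope] at hd
  have h1 := hd.mono_left (nhdsWithin_mono 1 fun x (hx : x ∈ Iio (1 : ℝ)) => ne_of_lt hx)
  have h2 : Tendsto (fun ζ : ℝ => ζ) (𝓝[<] 1) (𝓝 1) := tendsto_id.mono_left nhdsWithin_le_nhds
  have := h2.mul h1
  rw [one_mul] at this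
  refine this.congr fun ζ => ?_
  rw [slope_def_field, Real.one_rpow, shockRatio, ← neg_sub (ζ ^ γ) 1, ← neg_sub ζ 1,
    neg_div_neg_eq]

section shockDensity

variable {κ γ j : ℝ}

lemma shockDensity_pos (hκ : 0 < κ) (hγ : 1 < γ) (hj : 0 < j) {ζ : ℝ} (h0 : 0 < ζ)
    (h1 : ζ < 1) : 0 < shockDensity κ γ j ζ := by
  have := shockRatio_pos (by linarith : 0 < γ) h0 h1
  exact Real.rpow_pos_of_pos (by positivity) _

lemma shockDensity_rpow (hκ : 0 < κ) (hγ : 1 < γ) (hj : 0 < j) {ζ : ℝ} (h0 : 0 < ζ)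
    (h1 : ζ < 1) :
    shockDensity κ γ j ζ ^ (γ + 1) = j ^ 2 / (κ * shockRatio γ ζ) := by
  have := shockRatio_pos (by linarith : 0 < γ) h0 h1
  rw [shockDensity, ← Real.rpow_mul (by positivity), one_div_mul_cancel (by linarith),
    Real.rpow_one]

lemma shockDensity_antitone (hκ : 0 < κ) (hγ : 1 < γ) :
    AntitoneOn (shockDensity κ γ j) (Ioo 0 1) := by
  intro x hx y hy hxy
  have hx' := shockRatio_pos (by linarith : 0 < γ) hx.1 hx.2
  have hy' := shockRatio_pos (by linarith : 0 < γ) hy.1 hy.2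
  refine Real.rpow_le_rpow (by positivity) ?_ (by positivity)
  have := shockRatio_mono hγ hx hy hxy
  gcongr

lemma shockDensity_differentiableAt (hκ : 0 < κ) (hγ : 1 < γ) (hj : 0 < j) {ζ : ℝ}
    (h0 : 0 < ζ) (h1 : ζ < 1) : DifferentiableAt ℝ (shockDensity κ γ j) ζ := by
  have hr := shockRatio_pos (by linarith : 0 < γ) h0 h1
  have d1 : DifferentiableAt ℝ (shockRatio γ) ζ := by
    refine differentiableAt_id.mul (DifferentiableAt.div ?_ ?_ (sub_pos.2 h1).ne')
    · exact (Real.hasDerivAt_rpow_const (Or.inl h0.ne')).differentiableAt.const_sub 1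
    · exact differentiableAt_id.const_sub 1
  have d2 : DifferentiableAt ℝ (fun ζ => j ^ 2 / (κ * shockRatio γ ζ)) ζ :=
    (differentiableAt_const _).div (d1.const_mul κ) (by positivity)
  exact d2.rpow_const (Or.inl (by positivity))

lemma shockDensity_tendsto (hκ : 0 < κ) (hγ : 1 < γ) :
    Tendsto (shockDensity κ γ j) (𝓝[<] 1) (𝓝 ((j ^ 2 / (κ * γ)) ^ (1 / (γ + 1)))) := by
  have : Tendsto (fun ζ => j ^ 2 / (κ * shockRatio γ ζ)) (𝓝[<] 1) (𝓝 (j ^ 2 / (κ * γ))) :=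
    tendsto_const_nhds.div (shockRatio_tendsto.const_mul κ) (by positivity)
  exact this.rpow_const (Or.inr (by positivity))

end shockDensity

/-- Momentum flux at density `ρ` for the mass flux `j`. -/
noncomputable def impulse (κ γ j ρ : ℝ) : ℝ := j ^ 2 / ρ + κ * ρ ^ γ

lemma hasDerivAt_impulse {κ γ j ρ : ℝ} (hρ : 0 < ρ) :
    HasDerivAt (impulse κ γ j) (κ * (γ * ρ ^ (γ - 1)) - j ^ 2 / ρ ^ 2) ρ := by
  have d1 := (hasDerivAt_inv hρ.ne').const_mul (j ^ 2)
  have d2 := (Real.hasDerivAt_rpow_const (p := γ) (Or.inl hρ.ne')).const_mul κ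
  refine (d1.add d2).congr_deriv ?_
  field_simp
  ring

/-- Equal mass flux and equal impulse are the Rankine–Hugoniot conditions at zero speed: for fixed
`j`, `ζ` parametrizes a family of stationary shocks. -/
lemma impulse_shockDensity {κ γ j ζ : ℝ} (hκ : 0 < κ) (hγ : 1 < γ) (hj : 0 < j) (h0 : 0 < ζ)
    (h1 : ζ < 1) : impulse κ γ j (ζ * shockDensity κ γ j ζ)
      = impulse κ γ j (shockDensity κ γ j ζ) := by
  have hb := shockDensity_pos hκ hγ hj h0 h1
  have hp := shockDensity_rpow hκ hγ hj h0 h1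
  set b := shockDensity κ γ j ζ
  have hz : 0 < 1 - ζ ^ γ := sub_pos.2 (Real.rpow_lt_one h0.le h1 (by linarith))
  have hz1 : 0 < 1 - ζ := sub_pos.2 h1
  rw [Real.rpow_add_one hb.ne', shockRatio] at hp
  rw [impulse, impulse, Real.mul_rpow h0.le hb.le]
  field_simp at hp ⊢
  linear_combination -hp

/-- Conversely, every stationary shock with mass flux `j` belongs to the family. -/
lemma eq_shockDensity {κ γ j x y : ℝ} (hκ : 0 < κ) (hγ : 1 < γ) (hx : 0 < x)
    (hxy : x < y) (he : impulse κ γ j x = impulse κ γ j y) :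
    shockDensity κ γ j (x / y) = y := by
  have hy := hx.trans hxy
  have hyx : 0 < y - x := sub_pos.2 hxy
  have hp : 0 < y ^ γ - x ^ γ := sub_pos.2 (Real.rpow_lt_rpow hx.le hxy (by linarith))
  have hyγ : 0 < y ^ γ := Real.rpow_pos_of_pos hy _
  have e : j ^ 2 / (κ * shockRatio γ (x / y)) = y ^ (γ + 1) := by
    rw [impulse, impulse] at he
    rw [shockRatio, Real.div_rpow hx.le hy.le, Real.rpow_add_one hy.ne']
    field_simp at he ⊢
    linear_combination he
  rw [shockDensity, e, ← Real.rpow_mul hy.le, mul_one_div_cancel (by linarith), Real.rpow_one]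

namespace IsSmoothEvenConvex

variable {S S₁ S₂ : ℝ → ℝ} {l θ : ℝ}

/-- The arguments of `S₁` satisfy `V + R z ≤ U + r z` for all `z ≤ 1`; the critical point is `z =
1`, where second Riemann invariants are compared. -/
lemma mom_zero_mono (h : IsSmoothEvenConvex S S₁ S₂) (hl : 0 ≤ l) {U V r R : ℝ} (hrR : r ≤ R)
    (hUV : R - r ≤ U - V) : mom l 0 S₁ V R ≤ mom l 0 S₁ U r := by
  refine intervalIntegral.integral_mono_on (by norm_num)
    (mom_intervalIntegrable hl 0 h.continuous₁ _ _)
    (mom_intervalIntegrable hl 0 h.continuous₁ _ _) fun z hz => ?_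
  refine mul_le_mul_of_nonneg_left ?_ (weight_nonneg l hz)
  rw [pow_zero, one_mul, one_mul]
  refine h.monotone₁ ?_
  nlinarith [mul_nonneg (sub_nonneg.2 hrR) (sub_nonneg.2 hz.2)]

/-- At fixed mass flux `j`, the flux per unit of mass changes with the momentum flux. -/
lemma hasDerivAt_fluxMom_massFlux (h : IsSmoothEvenConvex S S₁ S₂) (hl : 0 < l)
    (hθl : θ * (2 * l + 1) = 1) {κ γ a j ρ : ℝ} (hγ : γ = 2 * θ + 1)
    (haκ : (a * θ) ^ 2 = κ * γ) (hj : 0 < j) (hρ : 0 < ρ) :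
    HasDerivAt (fun ρ => fluxMom l θ S (j / ρ) (a * ρ ^ θ) / (j / ρ))
      (mom l 0 S₁ (j / ρ) (a * ρ ^ θ) / j * (κ * (γ * ρ ^ (γ - 1)) - j ^ 2 / ρ ^ 2)) ρ := by
  have hU : ∀ t ∈ Ioi (0 : ℝ), HasDerivAt (fun t => j / t) (-(j / t ^ 2)) t := by
    intro t ht
    have := (hasDerivAt_inv (ne_of_gt ht)).const_mul j
    refine this.congr_deriv ?_
    ring
  have hr : ∀ t ∈ Ioi (0 : ℝ), HasDerivAt (fun t => a * t ^ θ) (a * (θ * t ^ (θ - 1))) t :=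
    fun t ht => (Real.hasDerivAt_rpow_const (Or.inl (ne_of_gt ht))).const_mul a
  have hU' : ContinuousOn (fun t : ℝ => -(j / t ^ 2)) (Ioi 0) :=
    (continuousOn_const.div (continuousOn_id.pow 2)
      fun t ht => pow_ne_zero 2 (ne_of_gt ht)).neg
  have hr' : ContinuousOn (fun t : ℝ => a * (θ * t ^ (θ - 1))) (Ioi 0) :=
    continuousOn_const.mul (continuousOn_const.mul
      (continuousOn_id.rpow_const fun t ht => Or.inl (ne_of_gt ht)))
  have hH := h.hasDerivAt_fluxMom hl isOpen_Ioi (θ := θ) hU hr hU' hr' (mem_Ioi.2 hρ)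
  refine (hH.div (hU ρ hρ) (div_pos hj hρ).ne').congr_deriv ?_
  have hp := mom_one_eq_theta hl hθl h.hasDeriv h.continuous₁ (j / ρ) (a * ρ ^ θ)
  have e1 : ρ ^ (γ - 1) = ρ ^ θ * ρ ^ θ := by
    rw [← Real.rpow_add hρ]; congr 1; rw [hγ]; ring
  have e2 : ρ ^ (θ - 1) = ρ ^ θ / ρ := Real.rpow_sub_one hρ.ne' θ
  -- Here `θ a ρ^θ` is the sound speed.
  have e3 : κ * (γ * (ρ ^ θ * ρ ^ θ)) = (θ * (a * ρ ^ θ)) ^ 2 := by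
    linear_combination (-(ρ ^ θ * ρ ^ θ)) * haκ
  have e4 : a * (θ * (ρ ^ θ / ρ)) = θ * (a * ρ ^ θ) / ρ := by ring
  rw [e1, e2, e3, e4, fluxMomU, fluxMomR, fluxMom]
  set r := a * ρ ^ θ
  set m0 := mom l 0 S (j / ρ) r
  set m1 := mom l 1 S (j / ρ) r
  set n0 := mom l 0 S₁ (j / ρ) r
  set n1 := mom l 1 S₁ (j / ρ) r
  set n2 := mom l 2 S₁ (j / ρ) r
  field_simp
  linear_combination θ * r * ρ ^ 2 * hp

/-- The entropy inequality for stationary shocks. -/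
lemma fluxMom_stationary_shock (h : IsSmoothEvenConvex S S₁ S₂) (hl : 0 < l) (hθ : 0 < θ)
    (hθl : θ * (2 * l + 1) = 1) {κ γ a j x y : ℝ} (hκ : 0 < κ) (hγ : γ = 2 * θ + 1)
    (ha : 0 < a) (haκ : (a * θ) ^ 2 = κ * γ) (hj : 0 < j) (hx : 0 < x) (hxy : x < y)
    (he : impulse κ γ j x = impulse κ γ j y) :
    fluxMom l θ S (j / y) (a * y ^ θ) / (j / y)
      ≤ fluxMom l θ S (j / x) (a * x ^ θ) / (j / x) := by
  have hγ1 : 1 < γ := by linarith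
  set K : ℝ → ℝ := fun ρ => fluxMom l θ S (j / ρ) (a * ρ ^ θ) / (j / ρ) with hK
  set b := shockDensity κ γ j with hb
  have hKd : ∀ ρ, 0 < ρ → HasDerivAt K
      (mom l 0 S₁ (j / ρ) (a * ρ ^ θ) / j * (κ * (γ * ρ ^ (γ - 1)) - j ^ 2 / ρ ^ 2)) ρ :=
    fun ρ hρ => h.hasDerivAt_fluxMom_massFlux hl hθl hγ haκ hj hρ
  have hbpos : ∀ ζ ∈ Ioo (0 : ℝ) 1, 0 < b ζ := fun ζ hζ =>
    shockDensity_pos hκ hγ1 hj hζ.1 hζ.2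
  have hbd : ∀ ζ ∈ Ioo (0 : ℝ) 1, HasDerivAt b (deriv b ζ) ζ := fun ζ hζ =>
    (shockDensity_differentiableAt hκ hγ1 hj hζ.1 hζ.2).hasDerivAt
  have hcd : ∀ ζ ∈ Ioo (0 : ℝ) 1,
      HasDerivAt (fun ζ => ζ * b ζ) (1 * b ζ + ζ * deriv b ζ) ζ := fun ζ hζ =>
    (hasDerivAt_id ζ).mul (hbd ζ hζ)
  -- Along the family both ends have the same impulse derivative in `ζ`, so the derivative of the
  -- jump of `K` is that common value times the difference of the moments of `S₁`, over `j`. The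
  -- moment is larger at the lower density, and the impulse does not increase with `ζ`.
  have hΔ : ∀ ζ ∈ Ioo (0 : ℝ) 1, ∃ D ≤ 0, HasDerivAt (fun ζ => K (ζ * b ζ) - K (b ζ)) D ζ := by
    intro ζ hζ
    have hbζ := hbpos ζ hζ
    have hcζ : 0 < ζ * b ζ := mul_pos hζ.1 hbζ
    have hlt : ζ * b ζ < b ζ := mul_lt_of_lt_one_left hbζ hζ.2
    have hPe := impulse_shockDensity hκ hγ1 hj hζ.1 hζ.2
    have hP : (κ * (γ * (ζ * b ζ) ^ (γ - 1)) - j ^ 2 / (ζ * b ζ) ^ 2)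
          * (1 * b ζ + ζ * deriv b ζ)
        = (κ * (γ * b ζ ^ (γ - 1)) - j ^ 2 / b ζ ^ 2) * deriv b ζ := by
      have d1 := (hasDerivAt_impulse (κ := κ) (γ := γ) (j := j) hcζ).comp ζ (hcd ζ hζ)
      have d2 := (hasDerivAt_impulse (κ := κ) (γ := γ) (j := j) hbζ).comp ζ (hbd ζ hζ)
      refine d1.unique (d2.congr_of_eventuallyEq ?_)
      filter_upwards [isOpen_Ioo.mem_nhds hζ] with ξ hξ
      exact impulse_shockDensity hκ hγ1 hj hξ.1 hξ.2
    have hbneg : deriv b ζ ≤ 0 := by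
      have := (shockDensity_antitone (j := j) hκ hγ1).derivWithin_nonpos (x := ζ)
      rwa [derivWithin_of_isOpen isOpen_Ioo hζ] at this
    have hPb : 0 ≤ κ * (γ * b ζ ^ (γ - 1)) - j ^ 2 / b ζ ^ 2 := by
      have hr := shockRatio_pos (by linarith : 0 < γ) hζ.1 hζ.2
      have hrl := shockRatio_le hγ1 hζ.1 hζ.2
      have e : b ζ ^ (γ - 1) = b ζ ^ (γ + 1) / b ζ ^ 2 := by
        rw [← Real.rpow_natCast, ← Real.rpow_sub hbζ]
        congr 1; push_cast; ring
      have e2 : κ * (γ * (j ^ 2 / (κ * shockRatio γ ζ) / b ζ ^ 2)) - j ^ 2 / b ζ ^ 2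
          = j ^ 2 / b ζ ^ 2 * ((γ - shockRatio γ ζ) / shockRatio γ ζ) := by
        field_simp
      rw [e, shockDensity_rpow hκ hγ1 hj hζ.1 hζ.2, e2]
      exact mul_nonneg (by positivity) (div_nonneg (sub_nonneg.2 hrl) hr.le)
    have hN : mom l 0 S₁ (j / b ζ) (a * b ζ ^ θ)
        ≤ mom l 0 S₁ (j / (ζ * b ζ)) (a * (ζ * b ζ) ^ θ) := by
      have hpow : (ζ * b ζ) ^ θ ≤ b ζ ^ θ := Real.rpow_le_rpow hcζ.le hlt.le hθ.le
      refine h.mom_zero_mono hl.le (mul_le_mul_of_nonneg_left hpow ha.le) ?_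
      -- The velocity drop across the shock is at least the increase of `a ρ^θ`, as the moment
      -- comparison requires.
      have hsq := rarefaction_jump_sq_le hκ hθ hγ haκ hcζ hlt
      rw [← mul_sub]
      have hd0 : 0 < 1 / (ζ * b ζ) - 1 / b ζ := sub_pos.2 (one_div_lt_one_div_of_lt hcζ hlt)
      have e1 : j / (ζ * b ζ) - j / b ζ = j * (1 / (ζ * b ζ) - 1 / b ζ) := by ring
      have e2 : κ * (b ζ ^ γ - (ζ * b ζ) ^ γ) = j ^ 2 * (1 / (ζ * b ζ) - 1 / b ζ) := by
        rw [impulse, impulse] at hPe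
        linear_combination -hPe
      rw [e1]
      refine abs_le_of_sq_le_sq' ?_ (by positivity) |>.2
      rw [e2] at hsq
      linarith
    have d1 := HasDerivAt.comp (h₂ := K) ζ (hKd _ hcζ) (hcd ζ hζ)
    have d2 := HasDerivAt.comp (h₂ := K) ζ (hKd _ hbζ) (hbd ζ hζ)
    refine ⟨_, ?_, d1.sub d2⟩
    rw [mul_assoc, mul_assoc, hP, ← sub_mul, ← sub_div]
    exact mul_nonpos_of_nonneg_of_nonpos (div_nonneg (sub_nonneg.2 hN) hj.le)
      (mul_nonpos_of_nonneg_of_nonpos hPb hbneg)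
  have hanti : AntitoneOn (fun ζ => K (ζ * b ζ) - K (b ζ)) (Ioo 0 1) := by
    choose! D hD hDd using hΔ
    refine antitoneOn_of_deriv_nonpos (convex_Ioo 0 1)
      (fun ζ hζ => (hDd ζ hζ).continuousAt.continuousWithinAt)
      (fun ζ hζ => (hDd ζ (interior_subset hζ)).differentiableAt.differentiableWithinAt)
      fun ζ hζ => ?_
    rw [(hDd ζ (interior_subset hζ)).deriv]
    exact hD ζ (interior_subset hζ)
  -- As `ζ → 1` the shock shrinks to the sonic state of density `β`, so a nonincreasing jump of `K`
  -- with limit zero is nonnegative.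
  have hlim : Tendsto (fun ζ => K (ζ * b ζ) - K (b ζ)) (𝓝[<] 1) (𝓝 0) := by
    set β := (j ^ 2 / (κ * γ)) ^ (1 / (γ + 1)) with hβ
    have hβ0 : 0 < β := Real.rpow_pos_of_pos (by positivity) _
    have hbl : Tendsto b (𝓝[<] 1) (𝓝 β) := shockDensity_tendsto hκ hγ1
    have hid : Tendsto (fun ζ : ℝ => ζ) (𝓝[<] 1) (𝓝 1) :=
      tendsto_id.mono_left nhdsWithin_le_nhds
    have hcl := hid.mul hbl
    rw [one_mul] at hcl
    have hKc : Tendsto K (𝓝 β) (𝓝 (K β)) := (hKd β hβ0).continuousAt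
    simpa using (hKc.comp hcl).sub (hKc.comp hbl)
  have hy := hx.trans hxy
  have hmem : x / y ∈ Ioo (0 : ℝ) 1 := ⟨div_pos hx hy, (div_lt_one hy).2 hxy⟩
  have hge : 0 ≤ K (x / y * b (x / y)) - K (b (x / y)) := by
    refine le_of_tendsto hlim ?_
    filter_upwards [Ioo_mem_nhdsLT hmem.2] with ζ hζ
    exact hanti hmem ⟨hmem.1.trans hζ.1, hζ.2⟩ hζ.1.le
  rw [hb, eq_shockDensity hκ hγ1 hx hxy he, div_mul_cancel₀ _ hy.ne'] at hge
  exact sub_nonneg.1 hge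

/-- Bound for states behind a shock that does not move into the pipe, with density smaller
than the one at the junction. -/
lemma mul_fluxMomU_le_of_shock (h : IsSmoothEvenConvex S S₁ S₂) (hl : 0 < l) (hθ : 0 < θ)
    (hθ1 : θ < 1) (hθl : θ * (2 * l + 1) = 1) {κ γ a U x y : ℝ} (hκ : 0 < κ)
    (hγ : γ = 2 * θ + 1) (ha : 0 < a) (haκ : (a * θ) ^ 2 = κ * γ) (hU : 0 < U) (hx : 0 < x)
    (hxy : x < y) (hUx : κ * ((y ^ γ - x ^ γ) / (y - x)) * y ≤ U ^ 2 * x) :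
    U * fluxMomU l θ S S₁ 0 (a * y ^ θ) ≤ fluxMom l θ S U (a * x ^ θ) := by
  have hy := hx.trans hxy
  have hyx : 0 < y - x := sub_pos.2 hxy
  have hp : 0 < y ^ γ - x ^ γ := sub_pos.2 (Real.rpow_lt_rpow hx.le hxy (by linarith))
  -- The mass flux of the stationary shock between `x` and `y`; the hypothesis on `U` says `U ≥ j /
  -- x`.
  set j := Real.sqrt (κ * ((y ^ γ - x ^ γ) / (y - x)) * y * x) with hj
  have hj2 : j ^ 2 = κ * ((y ^ γ - x ^ γ) / (y - x)) * y * x := Real.sq_sqrt (by positivity)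
  have hj0 : 0 < j := Real.sqrt_pos.2 (by positivity)
  have he : impulse κ γ j x = impulse κ γ j y := by
    rw [impulse, impulse, hj2]
    field_simp
    ring
  have hjU : j / x ≤ U := by
    rw [div_le_iff₀ hx]
    refine abs_le_of_sq_le_sq' ?_ (by positivity) |>.2
    rw [hj2, mul_pow]
    nlinarith
  have h1 := h.fluxMom_stationary_shock hl hθ hθl hκ hγ ha haκ hj0 hx hxy he
  have h2 := h.fluxMom_div_mono hl hθ hθ1 (a * x ^ θ) (div_pos hj0 hx) hjU
  have h3 := h.mul_fluxMomU_zero_le hl hθ hθ1 (a * y ^ θ) (div_pos hj0 hy)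
  have h4 : fluxMomU l θ S S₁ 0 (a * y ^ θ) ≤ fluxMom l θ S U (a * x ^ θ) / U := by
    refine le_trans ?_ (h1.trans h2)
    rw [le_div_iff₀ (div_pos hj0 hy)]
    linarith
  rw [le_div_iff₀ hU] at h4
  linarith

end IsSmoothEvenConvex

/-! ### Constants -/

section constants

variable {κ γ : ℝ}

lemma theta_pos (hγ₁ : 1 < γ) : 0 < theta γ := by rw [theta]; linarith

lemma theta_lt_one (hγ₃ : γ < 3) : theta γ < 1 := by rw [theta]; linarith

lemma lam_pos (hγ₁ : 1 < γ) (hγ₃ : γ < 3) : 0 < lam γ := by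
  rw [lam, sub_pos]
  exact one_div_lt_one_div_of_lt (by linarith) (by linarith)

lemma theta_mul_lam (hγ₁ : 1 < γ) : theta γ * (2 * lam γ + 1) = 1 := by
  have : γ - 1 ≠ 0 := by linarith
  rw [theta, lam]
  field_simp
  ring

lemma gamma_eq_theta : γ = 2 * theta γ + 1 := by rw [theta]; ring

lemma aConst_pos (hκ : 0 < κ) (hγ₁ : 1 < γ) : 0 < aConst κ γ := by
  have : 0 < γ - 1 := by linarith
  have : 0 < Real.sqrt (γ * κ) := Real.sqrt_pos.2 (by positivity)
  rw [aConst]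
  positivity

lemma aConst_mul_theta (hγ₁ : 1 < γ) : aConst κ γ * theta γ = Real.sqrt (κ * γ) := by
  have : γ - 1 ≠ 0 := by linarith
  rw [aConst, theta, mul_comm γ κ]
  field_simp

lemma aConst_mul_theta_sq (hκ : 0 < κ) (hγ₁ : 1 < γ) :
    (aConst κ γ * theta γ) ^ 2 = κ * γ := by
  rw [aConst_mul_theta hγ₁, Real.sq_sqrt (by positivity)]

lemma JConst_pos (hγ₁ : 1 < γ) (hγ₃ : γ < 3) : 0 < JConst γ := by
  refine intervalIntegral.intervalIntegral_pos_of_pos_on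
    ((continuous_weight (lam_pos hγ₁ hγ₃).le).intervalIntegrable _ _) (fun z hz => ?_)
    (by norm_num)
  exact Real.rpow_pos_of_pos (by nlinarith [hz.1, hz.2]) _

lemma lambda1_eq (hγ₁ : 1 < γ) (w : ℝ × ℝ) :
    lambda1 κ γ w = w.2 - theta γ * (aConst κ γ * w.1 ^ theta γ) := by
  rw [lambda1, ← aConst_mul_theta hγ₁]; ring

lemma lambda2_eq (hγ₁ : 1 < γ) (w : ℝ × ℝ) :
    lambda2 κ γ w = w.2 + theta γ * (aConst κ γ * w.1 ^ theta γ) := by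
  rw [lambda2, ← aConst_mul_theta hγ₁]; ring

end constants

/-! ### The entropy flux in terms of moments -/

/-- The change of variables `v = u + r z` turns `χ dv` into `(ρ / J) (1 - z²)^λ dz`. Powers of `r`
combine through `1 + 2 λ = 1 / θ`, and the constant `c` cancels the power of `a`. -/
lemma chi_mul_eq {κ γ ρ : ℝ} (hκ : 0 < κ) (hγ₁ : 1 < γ) (hγ₃ : γ < 3) (hρ : 0 < ρ) {z : ℝ}
    (hz : z ∈ Icc (-1 : ℝ) 1) :
    aConst κ γ * ρ ^ theta γ * chi κ γ ρ (aConst κ γ * ρ ^ theta γ * z)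
      = ρ / JConst γ * (1 - z ^ 2) ^ lam γ := by
  have ha := aConst_pos hκ hγ₁
  have hJ := JConst_pos hγ₁ hγ₃
  have hθ := theta_pos hγ₁
  have hγ0 : γ - 1 ≠ 0 := by linarith
  set r := aConst κ γ * ρ ^ theta γ with hr
  have hr0 : 0 < r := mul_pos ha (Real.rpow_pos_of_pos hρ _)
  have h1z : 0 ≤ 1 - z ^ 2 := by nlinarith [hz.1, hz.2]
  have e1 : aConst κ γ ^ 2 * ρ ^ (γ - 1) = r ^ 2 := by
    rw [hr, mul_pow, ← Real.rpow_natCast (ρ ^ theta γ), ← Real.rpow_mul hρ.le]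
    congr 2
    rw [theta]; push_cast; ring
  have e2 : max (r ^ 2 - (r * z) ^ 2) 0 = r ^ 2 * (1 - z ^ 2) := by
    rw [show r ^ 2 - (r * z) ^ 2 = r ^ 2 * (1 - z ^ 2) by ring]
    exact max_eq_left (by positivity)
  have e3 : r * (r ^ 2) ^ lam γ = r ^ (1 / theta γ) := by
    rw [← Real.rpow_natCast, ← Real.rpow_mul hr0.le]
    nth_rewrite 1 [← Real.rpow_one r]
    rw [← Real.rpow_add hr0]
    congr 1
    rw [eq_div_iff hθ.ne']
    push_cast
    linear_combination theta_mul_lam hγ₁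
  have e4 : r ^ (1 / theta γ) = aConst κ γ ^ (2 / (γ - 1)) * ρ := by
    rw [hr, Real.mul_rpow ha.le (Real.rpow_nonneg hρ.le _), ← Real.rpow_mul hρ.le,
      mul_one_div_cancel hθ.ne', Real.rpow_one]
    congr 2
    rw [theta]
    field_simp
  have e5 : aConst κ γ ^ (-(2 / (γ - 1))) * aConst κ γ ^ (2 / (γ - 1)) = 1 := by
    rw [← Real.rpow_add ha, neg_add_cancel, Real.rpow_zero]
  rw [chi, e1, e2, Real.mul_rpow (by positivity) h1z, cConst]
  calc r * (aConst κ γ ^ (-(2 / (γ - 1))) / JConst γ * ((r ^ 2) ^ lam γ * (1 - z ^ 2) ^ lam γ))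
      = aConst κ γ ^ (-(2 / (γ - 1))) * (r * (r ^ 2) ^ lam γ) / JConst γ
          * (1 - z ^ 2) ^ lam γ := by ring
    _ = aConst κ γ ^ (-(2 / (γ - 1))) * aConst κ γ ^ (2 / (γ - 1)) * (ρ / JConst γ)
          * (1 - z ^ 2) ^ lam γ := by rw [e3, e4]; ring
    _ = _ := by rw [e5, one_mul]

lemma chi_eq_zero {κ γ ρ : ℝ} (hγ₁ : 1 < γ) (hγ₃ : γ < 3) (hρ : 0 < ρ) {z : ℝ}
    (hz : z ∉ Icc (-1 : ℝ) 1) : chi κ γ ρ (aConst κ γ * ρ ^ theta γ * z) = 0 := by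
  have h1 : 1 ≤ z ^ 2 := by
    by_contra hc
    refine hz (abs_le.1 ?_)
    exact ((sq_lt_one_iff_abs_lt_one z).1 (not_le.1 hc)).le
  have e1 : aConst κ γ ^ 2 * ρ ^ (γ - 1) = (aConst κ γ * ρ ^ theta γ) ^ 2 := by
    rw [mul_pow, ← Real.rpow_natCast (ρ ^ theta γ), ← Real.rpow_mul hρ.le]
    congr 2
    rw [theta]; push_cast; ring
  rw [chi, e1, max_eq_right, Real.zero_rpow (lam_pos hγ₁ hγ₃).ne', mul_zero]
  nlinarith [mul_nonneg (sq_nonneg (aConst κ γ * ρ ^ theta γ)) (sub_nonneg.2 h1)]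

lemma entropyFlux_eq {κ γ : ℝ} (hκ : 0 < κ) (hγ₁ : 1 < γ) (hγ₃ : γ < 3) {S : ℝ → ℝ}
    (hS : Continuous S) {w : ℝ × ℝ} (hw : 0 < w.1) :
    entropyFlux κ γ S w = w.1 / JConst γ *
      fluxMom (lam γ) (theta γ) S w.2 (aConst κ γ * w.1 ^ theta γ) := by
  obtain ⟨ρ, u⟩ := w
  simp only at hw ⊢
  have ha := aConst_pos hκ hγ₁
  have hl := lam_pos hγ₁ hγ₃
  set r := aConst κ γ * ρ ^ theta γ with hr
  have hr0 : 0 < r := mul_pos ha (Real.rpow_pos_of_pos hw _)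
  set f : ℝ → ℝ := fun v =>
    ((1 - theta γ) * u + theta γ * v) * chi κ γ ρ (v - u) * S v with hf
  have e1 : entropyFlux κ γ S (ρ, u) = ∫ z, r * f (u + r * z) := by
    have h1 := integral_add_left_eq_self (μ := volume) f u
    have h2 := Measure.integral_comp_mul_left (fun v => f (u + v)) r
    rw [h1, abs_of_pos (inv_pos.2 hr0), smul_eq_mul] at h2
    rw [integral_const_mul, h2, mul_inv_cancel_left₀ hr0.ne']
    rfl
  have e2 : ∀ z ∉ Icc (-1 : ℝ) 1, r * f (u + r * z) = 0 := by
    intro z hz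
    simp only [hf]
    rw [add_sub_cancel_left, hr, chi_eq_zero hγ₁ hγ₃ hw hz]
    ring
  rw [e1, ← setIntegral_eq_integral_of_forall_compl_eq_zero e2, integral_Icc_eq_integral_Ioc,
    ← intervalIntegral.integral_of_le (by norm_num), fluxMom, mom, mom,
    ← intervalIntegral.integral_const_mul, ← intervalIntegral.integral_const_mul,
    ← intervalIntegral.integral_add ((mom_intervalIntegrable hl.le 0 hS _ _).const_mul _)
      ((mom_intervalIntegrable hl.le 1 hS _ _).const_mul _),
    ← intervalIntegral.integral_const_mul]
  refine intervalIntegral.integral_congr fun z hz => ?_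
  rw [uIcc_of_le (by norm_num)] at hz
  have hc := chi_mul_eq hκ hγ₁ hγ₃ hw hz
  rw [← hr] at hc
  simp only [hf]
  rw [add_sub_cancel_left]
  linear_combination (u + theta γ * r * z) * S (u + r * z) * hc

lemma entropyFlux_vacuum {κ γ : ℝ} (hγ₁ : 1 < γ) (hγ₃ : γ < 3) (S : ℝ → ℝ) {w : ℝ × ℝ}
    (hw : w.1 = 0) : entropyFlux κ γ S w = 0 := by
  have h0 : ∀ ξ, chi κ γ w.1 ξ = 0 := by
    intro ξ
    rw [chi, hw, Real.zero_rpow (by linarith), mul_zero, zero_sub,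
      max_eq_right (by nlinarith [sq_nonneg ξ]), Real.zero_rpow (lam_pos hγ₁ hγ₃).ne', mul_zero]
  simp [entropyFlux, h0]

/-! ### States at the junction -/

/-- The states that occur at `x / t = 0+` in Lax solutions with left state `(ρs, 0)`: states
at rest, states moving towards the junction with a density at least `ρs`, or with a smaller
density but fast enough to be behind a shock that does not enter the pipe, and subsonic states
on the `1`-rarefaction curve. -/
def IsJunctionState (κ γ ρs : ℝ) (w : ℝ × ℝ) : Prop :=
  w ∈ stateSpace ∧
    (w.2 = 0 ∨ (w.2 < 0 ∧ ρs ≤ w.1) ∨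
      (w.2 < 0 ∧ w.1 < ρs ∧
        κ * ((ρs ^ γ - w.1 ^ γ) / (ρs - w.1)) * ρs ≤ w.2 ^ 2 * w.1) ∨
      (0 < w.2 ∧ w.2 + aConst κ γ * w.1 ^ theta γ = aConst κ γ * ρs ^ theta γ ∧
        w.2 ≤ theta γ * (aConst κ γ * w.1 ^ theta γ)))

/-- The entropy flux of junction states is bounded by a common multiple of the mass flux. -/
lemma IsJunctionState.entropyFlux_le {κ γ ρs : ℝ} (hκ : 0 < κ) (hγ₁ : 1 < γ) (hγ₃ : γ < 3)
    {S S₁ S₂ : ℝ → ℝ} (h : IsSmoothEvenConvex S S₁ S₂) (hρs : 0 ≤ ρs) {w : ℝ × ℝ}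
    (hw : IsJunctionState κ γ ρs w) :
    entropyFlux κ γ S w ≤
      fluxMomU (lam γ) (theta γ) S S₁ 0 (aConst κ γ * ρs ^ theta γ) / JConst γ
        * (w.1 * w.2) := by
  obtain ⟨hD, hw⟩ := hw
  have ha := aConst_pos hκ hγ₁
  have hl := lam_pos hγ₁ hγ₃
  have hθ := theta_pos hγ₁
  have hθ1 := theta_lt_one hγ₃
  have hθl := theta_mul_lam hγ₁
  have hJ := JConst_pos hγ₁ hγ₃
  rcases hD with hpos | ⟨h0, -⟩
  swap
  · rw [entropyFlux_vacuum hγ₁ hγ₃ S h0, h0]; simp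
  rw [entropyFlux_eq hκ hγ₁ hγ₃ h.continuous hpos]
  set R := aConst κ γ * ρs ^ theta γ with hR
  set r := aConst κ γ * w.1 ^ theta γ with hr
  suffices hm : fluxMom (lam γ) (theta γ) S w.2 r
      ≤ w.2 * fluxMomU (lam γ) (theta γ) S S₁ 0 R by
    calc w.1 / JConst γ * fluxMom (lam γ) (theta γ) S w.2 r
        ≤ w.1 / JConst γ * (w.2 * fluxMomU (lam γ) (theta γ) S S₁ 0 R) := by gcongr
      _ = _ := by ring
  -- Oddness in the velocity reduces states moving towards the junction to a lower bound at positive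
  -- velocity.
  have hneg : -w.2 * fluxMomU (lam γ) (theta γ) S S₁ 0 R
      ≤ fluxMom (lam γ) (theta γ) S (-w.2) r →
      fluxMom (lam γ) (theta γ) S w.2 r ≤ w.2 * fluxMomU (lam γ) (theta γ) S S₁ 0 R := by
    intro hle
    rw [h.fluxMom_neg] at hle
    linarith
  rcases hw with hu | ⟨hu, hρ⟩ | ⟨hu, hρ, hsh⟩ | ⟨hu, hω, hsub⟩
  · rw [hu, h.fluxMom_zero, zero_mul]
  · refine hneg (h.mul_fluxMomU_le_of_le hl hθ hθ1 (neg_pos.2 hu)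
      (mul_nonneg ha.le (Real.rpow_nonneg hρs _)) ?_)
    exact mul_le_mul_of_nonneg_left (Real.rpow_le_rpow hρs hρ hθ.le) ha.le
  · refine hneg (h.mul_fluxMomU_le_of_shock hl hθ hθ1 hθl hκ gamma_eq_theta ha
      (aConst_mul_theta_sq hκ hγ₁) (neg_pos.2 hu) hpos hρ ?_)
    rwa [neg_sq]
  · rw [← hω]
    exact h.fluxMom_le_of_rarefaction hl hθ hθl hu hsub

/-! ### Limits of Lax profiles at the junction -/

section profiles

variable {κ γ : ℝ}

lemma continuous_fan1 (hγ₁ : 1 < γ) (w : ℝ × ℝ) : Continuous (fan1 κ γ w) := by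
  have hθ := theta_pos hγ₁
  refine Continuous.prodMk ?_ (by fun_prop)
  exact (Real.continuous_rpow_const (by positivity)).comp (by fun_prop)

lemma continuous_fan2 (hγ₁ : 1 < γ) (w : ℝ × ℝ) : Continuous (fan2 κ γ w) := by
  have hθ := theta_pos hγ₁
  refine Continuous.prodMk ?_ (by fun_prop)
  exact (Real.continuous_rpow_const (by positivity)).comp (by fun_prop)

lemma tendsto_of_continuous {g v : ℝ → ℝ × ℝ} (hg : Continuous g)
    (hv : ∀ᶠ ξ in 𝓝[>] (0 : ℝ), v ξ = g ξ) : Tendsto v (𝓝[>] 0) (𝓝 (g 0)) :=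
  ((hg.tendsto 0).mono_left nhdsWithin_le_nhds).congr'
    (hv.mono fun _ h => h.symm)

/-- On the ray `ξ = 0` the fan state is sonic, `λ₁ = 0`, so the subsonic bound holds with equality.
-/
lemma isJunctionState_fan1 (hκ : 0 < κ) (hγ₁ : 1 < γ) {ρs : ℝ} (hρs : 0 < ρs) :
    IsJunctionState κ γ ρs (fan1 κ γ (ρs, 0) 0) := by
  have ha := aConst_pos hκ hγ₁
  have hθ := theta_pos hγ₁
  set R := aConst κ γ * ρs ^ theta γ with hR
  have hR0 : 0 < R := mul_pos ha (Real.rpow_pos_of_pos hρs _)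
  have e1 : (fan1 κ γ (ρs, 0) 0).1 = (R / (aConst κ γ * (1 + theta γ))) ^ (1 / theta γ) := by
    simp [fan1, omega2, hR]
  have e2 : (fan1 κ γ (ρs, 0) 0).2 = theta γ * R / (1 + theta γ) := by
    simp [fan1, omega2, hR]
  have e3 : aConst κ γ * (fan1 κ γ (ρs, 0) 0).1 ^ theta γ = R / (1 + theta γ) := by
    rw [e1, ← Real.rpow_mul (by positivity), one_div_mul_cancel hθ.ne', Real.rpow_one]
    field_simp
  refine ⟨Or.inl ?_, Or.inr (Or.inr (Or.inr ⟨?_, ?_, ?_⟩))⟩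
  · rw [e1]; positivity
  · rw [e2]; positivity
  · rw [e2, e3]; field_simp; ring
  · rw [e2, e3]; apply le_of_eq; ring

lemma fan2_zero_fst_rpow (hκ : 0 < κ) (hγ₁ : 1 < γ) {r : ℝ × ℝ} (hω : omega1 κ γ r ≤ 0) :
    aConst κ γ * (fan2 κ γ r 0).1 ^ theta γ = -omega1 κ γ r / (1 + theta γ) := by
  have ha := aConst_pos hκ hγ₁
  have hθ := theta_pos hγ₁
  have : 0 ≤ -omega1 κ γ r / (aConst κ γ * (1 + theta γ)) :=
    div_nonneg (by linarith) (by positivity)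
  rw [fan2, zero_sub]
  simp only
  rw [← Real.rpow_mul this, one_div_mul_cancel hθ.ne', Real.rpow_one]
  field_simp

/-- A sonic state moving towards the junction, with density at least `ρs`. -/
lemma isJunctionState_fan2 (hκ : 0 < κ) (hγ₁ : 1 < γ) {ρs : ℝ} (hρs : 0 ≤ ρs)
    {r : ℝ × ℝ} (hω : omega1 κ γ r < 0)
    (hr : (1 + theta γ) * (aConst κ γ * ρs ^ theta γ) ≤ -omega1 κ γ r) :
    IsJunctionState κ γ ρs (fan2 κ γ r 0) := by
  have ha := aConst_pos hκ hγ₁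
  have hθ := theta_pos hγ₁
  have hpos : 0 < (fan2 κ γ r 0).1 := by
    refine Real.rpow_pos_of_pos (div_pos ?_ (by positivity)) _
    linarith
  refine ⟨Or.inl hpos, Or.inr (Or.inl ⟨?_, ?_⟩)⟩
  · have : (fan2 κ γ r 0).2 = theta γ * omega1 κ γ r / (1 + theta γ) := by simp [fan2]
    rw [this]
    exact div_neg_of_neg_of_pos (mul_neg_of_pos_of_neg hθ hω) (by positivity)
  · have e := fan2_zero_fst_rpow hκ hγ₁ hω.le
    have h1 : aConst κ γ * ρs ^ theta γ ≤ aConst κ γ * (fan2 κ γ r 0).1 ^ theta γ := by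
      rw [e, le_div_iff₀ (by positivity)]
      linarith
    exact (Real.rpow_le_rpow_iff hρs hpos.le hθ).1 (le_of_mul_le_mul_left h1 ha)

lemma eventually_lt_nhdsGT_zero {c : ℝ} (hc : 0 < c) : ∀ᶠ ξ in 𝓝[>] (0 : ℝ), ξ < c :=
  mem_of_superset (Ioo_mem_nhdsGT hc) fun _ h => h.2

lemma eventually_pos_nhdsGT_zero : ∀ᶠ ξ in 𝓝[>] (0 : ℝ), 0 < ξ := self_mem_nhdsWithin

/-- For `ρs > 0` the ray `x/t = 0+` lies in the complete 1-fan, as `λ₁ < 0 < ω₂` at rest. For `ρs =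
0` the limit is vacuum, a sonic state of the 2-fan, or `r` itself, and the bound `ρs ≤ ρ` is
automatic. -/
lemma vacuumProfile_limit (hκ : 0 < κ) (hγ₁ : 1 < γ) {ρs : ℝ} (hρs : 0 ≤ ρs) {r : ℝ × ℝ}
    (hr : r ∈ stateSpace) :
    ∃ w, IsJunctionState κ γ ρs w ∧
      Tendsto (vacuumProfile κ γ (ρs, 0) r) (𝓝[>] 0) (𝓝 w) := by
  have ha := aConst_pos hκ hγ₁
  have hθ := theta_pos hγ₁
  have hvac : IsJunctionState κ γ 0 (0, 0) := ⟨Or.inr ⟨rfl, rfl⟩, Or.inl rfl⟩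
  rcases hρs.eq_or_lt with rfl | hpos
  · by_cases hr0 : r.1 = 0
    · refine ⟨(0, 0), hvac, ?_⟩
      refine tendsto_of_continuous (g := fun _ => (0, 0)) continuous_const
        (Eventually.of_forall fun ξ => ?_)
      simp [vacuumProfile, hr0]
    have hrpos : 0 < r.1 := hr.resolve_right fun h => hr0 h.1
    have hrθ : 0 < aConst κ γ * r.1 ^ theta γ := mul_pos ha (Real.rpow_pos_of_pos hrpos _)
    rcases lt_or_ge 0 (omega1 κ γ r) with hω | hω
    · refine ⟨(0, 0), hvac, ?_⟩
      refine tendsto_of_continuous (g := fun _ => (0, 0)) continuous_const ?_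
      filter_upwards [eventually_lt_nhdsGT_zero hω] with ξ hξ
      simp [vacuumProfile, not_lt.2 hξ.le]
    rcases lt_or_ge 0 (lambda2 κ γ r) with hlam | hlam
    · refine ⟨fan2 κ γ r 0, ?_, ?_⟩
      -- If `ω₁(r) = 0` the fan begins exactly at `ξ = 0`, in the vacuum state.
      · rcases hω.eq_or_lt with hω | hω
        · have e : fan2 κ γ r 0 = (0, 0) := by
            have : (theta γ)⁻¹ ≠ 0 := inv_ne_zero hθ.ne'
            simp [fan2, hω, Real.zero_rpow this]
          rw [e]
          exact hvac
        · refine isJunctionState_fan2 hκ hγ₁ le_rfl hω ?_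
          rw [Real.zero_rpow hθ.ne']
          linarith
      · refine tendsto_of_continuous (continuous_fan2 hγ₁ r) ?_
        filter_upwards [eventually_lt_nhdsGT_zero hlam, eventually_pos_nhdsGT_zero] with ξ h1 h2
        simp [vacuumProfile, hr0, hω.trans_lt h2, h1]
    · refine ⟨r, ⟨hr, Or.inr (Or.inl ⟨?_, hrpos.le⟩)⟩, ?_⟩
      · rw [lambda2_eq hγ₁] at hlam
        nlinarith [mul_pos hθ hrθ]
      · refine tendsto_of_continuous (g := fun _ => r) continuous_const ?_
        filter_upwards [eventually_pos_nhdsGT_zero] with ξ h2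
        simp [vacuumProfile, hr0, hω.trans_lt h2, not_lt.2 (hlam.trans h2.le)]
  · refine ⟨fan1 κ γ (ρs, 0) 0, isJunctionState_fan1 hκ hγ₁ hpos, ?_⟩
    have hR0 : 0 < aConst κ γ * ρs ^ theta γ := mul_pos ha (Real.rpow_pos_of_pos hpos _)
    have hω : 0 < omega2 κ γ (ρs, 0) := by simpa [omega2] using hR0
    have hlam : lambda1 κ γ (ρs, 0) < 0 := by
      rw [lambda1_eq hγ₁]
      simpa using mul_pos hθ hR0
    refine tendsto_of_continuous (continuous_fan1 hγ₁ _) ?_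
    filter_upwards [eventually_lt_nhdsGT_zero hω, eventually_pos_nhdsGT_zero] with ξ h1 h2
    simp [vacuumProfile, hpos.ne', h1, not_le.2 (hlam.trans h2)]

lemma shockJump_nonneg (ρ ρ₀ : ℝ) : 0 ≤ shockJump κ γ ρ ρ₀ := Real.sqrt_nonneg _

lemma shockJump_sq (hκ : 0 < κ) (hγ₁ : 1 < γ) {x y : ℝ} (hx : 0 < x) (hxy : x < y) :
    0 < shockJump κ γ x y ∧
      shockJump κ γ x y ^ 2 = κ * (y ^ γ - x ^ γ) * (y - x) / (x * y) := by
  have hy := hx.trans hxy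
  have h1 : 0 < y - x := sub_pos.2 hxy
  have h2 : 0 < y ^ γ - x ^ γ := sub_pos.2 (Real.rpow_lt_rpow hx.le hxy (by linarith))
  have e : κ * (x ^ γ - y ^ γ) * (x - y) / (x * y) = κ * (y ^ γ - x ^ γ) * (y - x) / (x * y) := by
    ring
  rw [shockJump, e]
  exact ⟨Real.sqrt_pos.2 (by positivity), Real.sq_sqrt (by positivity)⟩

/-- The state behind a `2`-shock of nonpositive speed. -/
lemma isJunctionState_shock (hκ : 0 < κ) (hγ₁ : 1 < γ) {ρs : ℝ} (hρs : 0 < ρs)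
    {m r : ℝ × ℝ} (hm : ρs ≤ m.1) (hm2 : m.2 ≤ 0) (hr : 0 < r.1) (hrm : r.1 < m.1)
    (hu : r.2 = m.2 - shockJump κ γ r.1 m.1) (hs : shockSpeed m r ≤ 0) :
    IsJunctionState κ γ ρs r := by
  obtain ⟨x, u⟩ := r
  obtain ⟨y, v⟩ := m
  simp only at hm hm2 hr hrm hu
  obtain ⟨hJ, hJ2⟩ := shockJump_sq hκ hγ₁ hr hrm
  have hy := hr.trans hrm
  have hyx : 0 < y - x := sub_pos.2 hrm
  have hu0 : u < 0 := by linarith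
  refine ⟨Or.inl hr, Or.inr ?_⟩
  rcases le_or_gt ρs x with hx | hx
  · exact Or.inl ⟨hu0, hx⟩
  refine Or.inr (Or.inl ⟨hu0, hx, ?_⟩)
  simp only
  -- Nonpositive shock speed forces `|u|` to be at least the stationary value `y * shockJump / (y -
  -- x)`.
  have h1 : y * shockJump κ γ x y ≤ -u * (y - x) := by
    rw [shockSpeed] at hs
    simp only at hs
    rw [← neg_sub y x, div_neg, neg_nonpos, le_div_iff₀ hyx] at hs
    rw [show v = u + shockJump κ γ x y by linarith] at hs
    linarith
  have h2 : y ^ 2 * shockJump κ γ x y ^ 2 ≤ u ^ 2 * (y - x) ^ 2 := by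
    have := pow_le_pow_left₀ (by positivity) h1 2
    rw [mul_pow, mul_pow, neg_sq] at this
    exact this
  have h3 : κ * ((y ^ γ - x ^ γ) / (y - x)) * y ≤ u ^ 2 * x := by
    rw [hJ2] at h2
    have e : κ * ((y ^ γ - x ^ γ) / (y - x)) * y
        = y ^ 2 * (κ * (y ^ γ - x ^ γ) * (y - x) / (x * y)) * (x / (y - x) ^ 2) := by
      field_simp
    rw [e]
    calc _ ≤ u ^ 2 * (y - x) ^ 2 * (x / (y - x) ^ 2) := by gcongr
      _ = u ^ 2 * x := by field_simp
  -- The secant slopes of `ρ^γ` are monotone, so the estimate at the density of `m` implies the one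
  -- at `ρs ≤ m.1`.
  have h4 : (ρs ^ γ - x ^ γ) / (ρs - x) ≤ (y ^ γ - x ^ γ) / (y - x) :=
    (convexOn_rpow hγ₁.le).secant_mono (mem_Ici.2 hr.le) (mem_Ici.2 hρs.le) (mem_Ici.2 hy.le)
      hx.ne' hrm.ne' hm
  refine le_trans ?_ h3
  have h5 : 0 ≤ (y ^ γ - x ^ γ) / (y - x) :=
    div_nonneg (sub_nonneg.2 (Real.rpow_le_rpow hr.le hrm.le (by linarith))) hyx.le
  gcongr

/-- The ray `ξ = m.2` separates the waves. If `m.2 > 0`, the 1-wave is a rarefaction, since a shock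
cannot raise the velocity from rest, and the limit is its sonic state or `m`. If `m.2 ≤ 0`, then
`m.1 ≥ ρs` and the 2-wave decides: the limit is `m`, a sonic fan state or `r`. -/
lemma laxProfile_limit (hκ : 0 < κ) (hγ₁ : 1 < γ) {ρs : ℝ} (hρs : 0 < ρs) {m r : ℝ × ℝ}
    (hm : m ∈ waveCurve1 κ γ (ρs, 0)) (hr : r ∈ waveCurve2 κ γ m) :
    ∃ w, IsJunctionState κ γ ρs w ∧
      Tendsto (laxProfile κ γ (ρs, 0) m r) (𝓝[>] 0) (𝓝 w) := by
  have ha := aConst_pos hκ hγ₁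
  have hθ := theta_pos hγ₁
  obtain ⟨hm0, hm⟩ := hm
  obtain ⟨hr0, hr⟩ := hr
  have hR0 : 0 < aConst κ γ * ρs ^ theta γ := mul_pos ha (Real.rpow_pos_of_pos hρs _)
  have hmθ : 0 < aConst κ γ * m.1 ^ theta γ := mul_pos ha (Real.rpow_pos_of_pos hm0 _)
  have hrθ : 0 < aConst κ γ * r.1 ^ theta γ := mul_pos ha (Real.rpow_pos_of_pos hr0 _)
  have hlam : lambda1 κ γ (ρs, 0) < 0 := by
    rw [lambda1_eq hγ₁]
    simpa using mul_pos hθ hR0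
  rcases lt_or_ge 0 m.2 with hm2 | hm2
  · obtain ⟨hle, hmu⟩ := hm.resolve_right fun h => by
      have := shockJump_nonneg (κ := κ) (γ := γ) m.1 ρs
      have h2 := h.2
      simp only at h2
      linarith
    simp only [zero_add] at hle hmu
    rcases lt_or_ge 0 (lambda1 κ γ m) with hlm | hlm
    · refine ⟨fan1 κ γ (ρs, 0) 0, isJunctionState_fan1 hκ hγ₁ hρs, ?_⟩
      refine tendsto_of_continuous (continuous_fan1 hγ₁ _) ?_
      filter_upwards [eventually_lt_nhdsGT_zero hm2, eventually_lt_nhdsGT_zero hlm,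
        eventually_pos_nhdsGT_zero] with ξ h1 h2 h3
      simp [laxProfile, wave1, h1, hle, h2, not_le.2 (hlam.trans h3)]
    · refine ⟨m, ⟨Or.inl hm0, Or.inr (Or.inr (Or.inr ⟨hm2, by linarith, ?_⟩))⟩, ?_⟩
      · rw [lambda1_eq hγ₁] at hlm
        linarith
      · refine tendsto_of_continuous (g := fun _ => m) continuous_const ?_
        filter_upwards [eventually_lt_nhdsGT_zero hm2, eventually_pos_nhdsGT_zero] with ξ h1 h3
        simp [laxProfile, wave1, h1, hle, not_lt.2 (hlm.trans h3.le), not_le.2 (hlam.trans h3)]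
  · have hρm : ρs ≤ m.1 := by
      rcases hm with ⟨-, hmu⟩ | ⟨hlt, -⟩
      · simp only [zero_add] at hmu
        have : aConst κ γ * ρs ^ theta γ ≤ aConst κ γ * m.1 ^ theta γ := by linarith
        exact (Real.rpow_le_rpow_iff hρs.le hm0.le hθ).1 (le_of_mul_le_mul_left this ha)
      · exact hlt.le
    have hmJ : IsJunctionState κ γ ρs m :=
      ⟨Or.inl hm0, hm2.eq_or_lt.imp id fun h => Or.inl ⟨h, hρm⟩⟩
    rcases hr with ⟨hle, hru⟩ | ⟨hlt, hru⟩
    · rcases lt_or_ge 0 (lambda2 κ γ m) with hlm | hlm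
      · refine ⟨m, hmJ, tendsto_of_continuous (g := fun _ => m) continuous_const ?_⟩
        filter_upwards [eventually_lt_nhdsGT_zero hlm, eventually_pos_nhdsGT_zero] with ξ h1 h3
        simp [laxProfile, wave2, not_lt.2 (hm2.trans h3.le), hle, h1.le]
      have hω : omega1 κ γ r = m.2 - aConst κ γ * m.1 ^ theta γ := by
        rw [omega1, hru]; ring
      have hlm' := hlm
      rw [lambda2_eq hγ₁] at hlm'
      rcases lt_or_ge 0 (lambda2 κ γ r) with hlr | hlr
      · refine ⟨fan2 κ γ r 0, isJunctionState_fan2 hκ hγ₁ hρs.le (by rw [hω]; linarith) ?_, ?_⟩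
        -- `ω₁(r) = ω₁(m)` and `λ₂(m) ≤ 0` give `-ω₁(r) ≥ (1 + θ) a m.1^θ`, and `m.1 ≥ ρs`.
        · have h1 : aConst κ γ * ρs ^ theta γ ≤ aConst κ γ * m.1 ^ theta γ :=
            mul_le_mul_of_nonneg_left (Real.rpow_le_rpow hρs.le hρm hθ.le) ha.le
          have h2 := mul_le_mul_of_nonneg_left h1 hθ.le
          rw [hω]
          linarith
        · refine tendsto_of_continuous (continuous_fan2 hγ₁ _) ?_
          filter_upwards [eventually_lt_nhdsGT_zero hlr, eventually_pos_nhdsGT_zero] with ξ h1 h3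
          simp [laxProfile, wave2, not_lt.2 (hm2.trans h3.le), hle, h1,
            not_le.2 (hlm.trans_lt h3)]
      · refine ⟨r, ⟨Or.inl hr0, Or.inr (Or.inl ⟨?_, hρm.trans hle⟩)⟩, ?_⟩
        · rw [lambda2_eq hγ₁] at hlr
          linarith [mul_pos hθ hrθ]
        · refine tendsto_of_continuous (g := fun _ => r) continuous_const ?_
          filter_upwards [eventually_pos_nhdsGT_zero] with ξ h3
          simp [laxProfile, wave2, not_lt.2 (hm2.trans h3.le), hle,
            not_lt.2 (hlr.trans h3.le), not_le.2 (hlm.trans_lt h3)]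
    · rcases lt_or_ge 0 (shockSpeed m r) with hs | hs
      · refine ⟨m, hmJ, tendsto_of_continuous (g := fun _ => m) continuous_const ?_⟩
        filter_upwards [eventually_lt_nhdsGT_zero hs, eventually_pos_nhdsGT_zero] with ξ h1 h3
        simp [laxProfile, wave2, not_lt.2 (hm2.trans h3.le), not_le.2 hlt, h1]
      · refine ⟨r, isJunctionState_shock hκ hγ₁ hρs hρm hm2 hr0 hlt hru hs,
          tendsto_of_continuous (g := fun _ => r) continuous_const ?_⟩
        filter_upwards [eventually_pos_nhdsGT_zero] with ξ h3
        simp [laxProfile, wave2, not_lt.2 (hm2.trans h3.le), not_le.2 hlt,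
          not_lt.2 (hs.trans h3.le)]

/-- Lax solutions with left state `(ρs, 0)` have a limit at `x / t = 0+`, a junction state. -/
lemma IsLaxProfile.exists_limit (hκ : 0 < κ) (hγ₁ : 1 < γ) {ρs : ℝ} (hρs : 0 ≤ ρs)
    {r : ℝ × ℝ} {v : ℝ → ℝ × ℝ} (h : IsLaxProfile κ γ (ρs, 0) r v) :
    ∃ w, IsJunctionState κ γ ρs w ∧ Tendsto v (𝓝[>] 0) (𝓝 w) := by
  obtain ⟨-, hr, ⟨hl, -, m, hm, hrm, rfl⟩ | ⟨-, rfl⟩⟩ := h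
  · exact laxProfile_limit hκ hγ₁ hl hm hrm
  · exact vacuumProfile_limit hκ hγ₁ hρs hr

lemma isJunctionState_of_mem_boundarySet (hκ : 0 < κ) (hγ₁ : 1 < γ) {ρs : ℝ} (hρs : 0 ≤ ρs)
    {w : ℝ × ℝ} (hw : w ∈ boundarySet κ γ (ρs, 0)) : IsJunctionState κ γ ρs w := by
  obtain ⟨-, r, -, v, hv, hlim⟩ := hw
  obtain ⟨w', hw', hlim'⟩ := hv.exists_limit hκ hγ₁ hρs
  rwa [tendsto_nhds_unique hlim hlim']

end profiles

/-! ### Regularization of convex functions -/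

/-- The average of `S` over `[v - ε, v + ε]`. -/
noncomputable def average (ε : ℝ) (S : ℝ → ℝ) (v : ℝ) : ℝ :=
  1 / 2 * ∫ t in (-1 : ℝ)..1, S (v + ε * t)

/-- Scaling the average to `[-1, 1]` keeps it continuous up to `ε = 0`; letting `S` depend on `ε`
allows the averaging to be iterated. -/
lemma continuous_average {S : ℝ → ℝ → ℝ} (hS : Continuous fun p : ℝ × ℝ => S p.1 p.2) :
    Continuous fun p : ℝ × ℝ => average p.1 (S p.1) p.2 := by
  refine continuous_const.mul
    (intervalIntegral.continuous_parametric_intervalIntegral_of_continuous'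
      (f := fun (p : ℝ × ℝ) t => S p.1 (p.2 + p.1 * t)) ?_ _ _)
  exact hS.comp (g := fun p : ℝ × ℝ => S p.1 p.2)
    (f := fun q : (ℝ × ℝ) × ℝ => (q.1.1, q.1.2 + q.1.1 * q.2)) (by fun_prop)

lemma average_zero (S : ℝ → ℝ) : average 0 S = S := by
  funext v
  simp only [average, zero_mul, add_zero, intervalIntegral.integral_const, smul_eq_mul]
  ring

lemma average_neg {S : ℝ → ℝ} (hS : ∀ v, S (-v) = S v) (ε v : ℝ) :
    average ε S (-v) = average ε S v := by
  have := intervalIntegral.integral_comp_neg (a := (-1 : ℝ)) (b := 1)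
    (fun t => S (-v + ε * t))
  rw [neg_neg] at this
  rw [average, average, ← this]
  congr 1
  refine intervalIntegral.integral_congr fun t _ => ?_
  rw [← hS]
  congr 1
  ring

lemma hasDerivAt_average {S : ℝ → ℝ} (hS : Continuous S) {ε : ℝ} (hε : 0 < ε) (v : ℝ) :
    HasDerivAt (average ε S) ((S (v + ε) - S (v - ε)) / (2 * ε)) v := by
  have hprim : ∀ x, HasDerivAt (fun x => ∫ s in (0 : ℝ)..x, S s) (S x) x := fun x =>
    intervalIntegral.integral_hasDerivAt_right (hS.intervalIntegrable _ _)
      (hS.stronglyMeasurableAtFilter _ _) hS.continuousAt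
  have e : average ε S = fun v =>
      ((∫ s in (0 : ℝ)..(v + ε), S s) - ∫ s in (0 : ℝ)..(v - ε), S s) / (2 * ε) := by
    funext v
    have h1 := intervalIntegral.mul_integral_comp_add_mul (f := S) (a := -1) (b := 1) ε v
    rw [mul_one, mul_neg, mul_one, ← sub_eq_add_neg] at h1
    rw [average, intervalIntegral.integral_interval_sub_left (hS.intervalIntegrable _ _)
      (hS.intervalIntegrable _ _), ← h1]
    field_simp
  rw [e]
  have d1 := (hprim (v + ε)).comp v ((hasDerivAt_id v).add_const ε)
  have d2 := (hprim (v - ε)).comp v ((hasDerivAt_id v).sub_const ε)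
  rw [mul_one] at d1 d2
  exact (d1.sub d2).div_const _

/-- The slope over `[x - ε, y + ε]` lies between the slopes over `[x - ε, x + ε]` and `[y - ε, y +
ε]`. -/
lemma monotone_central_difference {S : ℝ → ℝ} (hS : ConvexOn ℝ univ S) {ε : ℝ} (hε : 0 < ε) :
    Monotone fun v => (S (v + ε) - S (v - ε)) / (2 * ε) := by
  intro x y hxy
  have h1 := hS.secant_mono (a := x - ε) (x := x + ε) (y := y + ε) (mem_univ _) (mem_univ _)
    (mem_univ _) (by linarith) (by linarith) (by linarith)
  have h2 := hS.secant_mono (a := y + ε) (x := x - ε) (y := y - ε) (mem_univ _) (mem_univ _)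
    (mem_univ _) (by linarith) (by linarith) (by linarith)
  have e1 : (S (x - ε) - S (y + ε)) / (x - ε - (y + ε))
      = (S (y + ε) - S (x - ε)) / (y + ε - (x - ε)) := by
    rw [← neg_sub (S (y + ε)), ← neg_sub (y + ε), neg_div_neg_eq]
  have e2 : (S (y - ε) - S (y + ε)) / (y - ε - (y + ε))
      = (S (y + ε) - S (y - ε)) / (2 * ε) := by
    rw [← neg_sub (S (y + ε)), ← neg_sub (y + ε), neg_div_neg_eq]
    congr 1; ring
  rw [e1, e2] at h2
  rw [show x + ε - (x - ε) = 2 * ε by ring] at h1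
  exact h1.trans h2

/-- Averaging an even convex function twice makes it twice continuously differentiable. -/
lemma isSmoothEvenConvex_average {S : ℝ → ℝ} (hS : ConvexOn ℝ univ S)
    (hSe : ∀ v, S (-v) = S v) (hc : Continuous S) {ε : ℝ} (hε : 0 < ε) :
    ∃ S₁ S₂, IsSmoothEvenConvex (average ε (average ε S)) S₁ S₂ := by
  have hd := hasDerivAt_average hc hε
  have hc1 : Continuous (average ε S) :=
    continuous_iff_continuousAt.2 fun v => (hd v).continuousAt
  refine ⟨fun v => (average ε S (v + ε) - average ε S (v - ε)) / (2 * ε),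
    fun v => ((S (v + ε + ε) - S (v + ε - ε)) / (2 * ε)
      - (S (v - ε + ε) - S (v - ε - ε)) / (2 * ε)) / (2 * ε), ?_⟩
  refine ⟨hasDerivAt_average hc1 hε, fun v => ?_, by fun_prop, fun v => ?_,
    average_neg (average_neg hSe ε) ε⟩
  · have d1 := (hd (v + ε)).comp v ((hasDerivAt_id v).add_const ε)
    have d2 := (hd (v - ε)).comp v ((hasDerivAt_id v).sub_const ε)
    rw [mul_one] at d1 d2
    exact (d1.sub d2).div_const _
  · refine div_nonneg (sub_nonneg.2 ?_) (by positivity)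
    exact monotone_central_difference hS hε (by linarith)

/-! ### The entropy inequality at the junction -/

lemma continuous_fluxMom {l : ℝ} (hl : 0 ≤ l) (θ U r : ℝ) {S : ℝ → ℝ → ℝ}
    (hS : Continuous fun p : ℝ × ℝ => S p.1 p.2) :
    Continuous fun ε => fluxMom l θ (S ε) U r := by
  have hm : ∀ k, Continuous fun ε => mom l k (S ε) U r := by
    intro k
    refine intervalIntegral.continuous_parametric_intervalIntegral_of_continuous' ?_ _ _
    refine ((continuous_weight hl).comp continuous_snd).mul
      ((continuous_snd.pow k).mul ?_)
    exact hS.comp (g := fun p : ℝ × ℝ => S p.1 p.2)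
      (f := fun q : ℝ × ℝ => (q.1, U + r * q.2)) (by fun_prop)
  exact ((hm 0).const_mul U).add ((hm 1).const_mul (θ * r))

/-- The constant `C` in the bound by the mass flux depends on `ρs` but not on `k`, so mass
conservation annihilates the sum of the bounds. This is done for the double averages, and `ε → 0`
gives the case of merely convex `S`. -/
lemma sum_entropyFlux_nonpos {κ γ : ℝ} (hκ : 0 < κ) (hγ₁ : 1 < γ) (hγ₃ : γ < 3) {d : ℕ}
    {A : Fin d → ℝ} (hA : ∀ k, 0 < A k) {S : ℝ → ℝ} (hS : ConvexOn ℝ univ S)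
    (hSe : ∀ v, S v = S (-v)) {ρs : ℝ} (hρs : 0 ≤ ρs) {w : Fin d → ℝ × ℝ}
    (hw : ∀ k, IsJunctionState κ γ ρs (w k)) (hmass : ∑ k, A k * ((w k).1 * (w k).2) = 0) :
    ∑ k, A k * entropyFlux κ γ S (w k) ≤ 0 := by
  have hc : Continuous S := by
    rw [← continuousOn_univ]
    exact hS.continuousOn isOpen_univ
  set T : ℝ → ℝ → ℝ := fun ε => average ε (average ε S) with hT
  have hT0 : T 0 = S := by simp only [hT, average_zero]
  have hTc : Continuous fun p : ℝ × ℝ => T p.1 p.2 :=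
    continuous_average (S := fun ε => average ε S)
      (continuous_average (S := fun _ => S) (hc.comp continuous_snd))
  have hcont : Continuous fun ε => ∑ k, A k * entropyFlux κ γ (T ε) (w k) := by
    refine continuous_finsetSum _ fun k _ => continuous_const.mul ?_
    rcases (hw k).1 with hpos | ⟨h0, -⟩
    · have e : (fun ε => entropyFlux κ γ (T ε) (w k)) = fun ε => (w k).1 / JConst γ *
          fluxMom (lam γ) (theta γ) (T ε) (w k).2 (aConst κ γ * (w k).1 ^ theta γ) := by
        funext ε
        exact entropyFlux_eq hκ hγ₁ hγ₃
          (hTc.comp (continuous_const.prodMk continuous_id)) hpos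
      rw [e]
      exact (continuous_fluxMom (lam_pos hγ₁ hγ₃).le _ _ _ hTc).const_mul _
    · simp only [entropyFlux_vacuum hγ₁ hγ₃ _ h0]
      exact continuous_const
  have hlim := (hcont.tendsto 0).mono_left (nhdsWithin_le_nhds (s := Ioi 0))
  rw [hT0] at hlim
  refine le_of_tendsto hlim ?_
  filter_upwards [self_mem_nhdsWithin] with ε hε
  obtain ⟨S₁, S₂, h⟩ := isSmoothEvenConvex_average hS (fun v => (hSe v).symm) hc hε
  set C := fluxMomU (lam γ) (theta γ) (T ε) S₁ 0 (aConst κ γ * ρs ^ theta γ) / JConst γ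
  calc ∑ k, A k * entropyFlux κ γ (T ε) (w k)
      ≤ ∑ k, A k * (C * ((w k).1 * (w k).2)) := Finset.sum_le_sum fun k _ =>
        mul_le_mul_of_nonneg_left ((hw k).entropyFlux_le hκ hγ₁ hγ₃ h hρs) (hA k).le
    _ = C * ∑ k, A k * ((w k).1 * (w k).2) := by
        rw [Finset.mul_sum]
        exact Finset.sum_congr rfl fun k _ => by ring
    _ = 0 := by rw [hmass, mul_zero]

/-! ### Traces -/

/-- Makes essential limits at `0+` unique: each interval `(0, ε)` has positive measure. -/
lemma neBot_nhdsGT_inf_ae : (𝓝[>] (0 : ℝ) ⊓ ae volume).NeBot := by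
  rw [inf_neBot_iff]
  intro s hs s' hs'
  obtain ⟨ε, hε, hsub⟩ := mem_nhdsGT_iff_exists_Ioo_subset.1 hs
  have hpos : volume (Ioo 0 ε ∩ s') ≠ 0 := by
    rw [measure_inter_conull hs', Real.volume_Ioo, sub_zero]
    simpa using hε
  exact (nonempty_of_measure_ne_zero hpos).mono (inter_subset_inter_left _ hsub)

/-- A trace of the conserved quantities determines the state because `D` contains only one vacuum
state. -/
lemma cons_injOn : InjOn cons stateSpace := by
  rintro ⟨ρ, u⟩ h ⟨ρ', u'⟩ h' he
  simp only [cons, Prod.mk.injEq] at he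
  obtain ⟨rfl, he⟩ := he
  rcases h with h | ⟨h0, h⟩
  · rw [mul_left_cancel₀ (ne_of_gt h) he]
  · rcases h' with h' | ⟨-, h'⟩
    · exact absurd h0 (ne_of_gt h')
    · simp only at h h'
      rw [h, h']

lemma continuous_cons : Continuous cons := by
  unfold cons
  fun_prop

/-- The junction trace of a self-similar function is the limit of its profile. -/
lemma IsJunctionTrace.eq_of_selfSimilar {U : ℝ → ℝ → ℝ × ℝ} {Ubar : ℝ → ℝ × ℝ}
    (h : IsJunctionTrace (Ioi 0) U Ubar) {v : ℝ → ℝ × ℝ} {w : ℝ × ℝ} (hw : w ∈ stateSpace)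
    (hv : Tendsto v (𝓝[>] 0) (𝓝 w))
    (hU : ∀ᵐ p : ℝ × ℝ ∂(volume.restrict (Ioi 0 ×ˢ Ioi 0)), U p.1 p.2 = v (p.2 / p.1)) :
    ∀ᵐ t ∂(volume.restrict (Ioi (0 : ℝ))), Ubar t = w := by
  -- Fubini: for a.e. `t` the self-similar formula holds for a.e. `x`, enough for an essential
  -- limit.
  rw [Measure.volume_eq_prod, ← Measure.prod_restrict] at hU
  filter_upwards [Measure.ae_ae_of_ae_prod hU, h, ae_restrict_mem measurableSet_Ioi]
    with t hx htr ht
  have ht : 0 < t := ht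
  rw [ae_restrict_iff' measurableSet_Ioi] at hx
  refine cons_injOn htr.1 hw ?_
  have hdiv : Tendsto (fun x : ℝ => x / t) (𝓝[>] 0) (𝓝[>] 0) := by
    refine tendsto_nhdsWithin_iff.2 ⟨?_, ?_⟩
    · have : Tendsto (fun x : ℝ => x / t) (𝓝 0) (𝓝 (0 / t)) := tendsto_id.div_const t
      rw [zero_div] at this
      exact this.mono_left nhdsWithin_le_nhds
    · filter_upwards [self_mem_nhdsWithin] with x hx
      exact div_pos hx ht
  have hlim : Tendsto (fun x => cons (v (x / t))) (𝓝[>] (0 : ℝ) ⊓ ae volume) (𝓝 (cons w)) :=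
    ((continuous_cons.tendsto w).comp (hv.comp hdiv)).mono_left inf_le_left
  have heq : (fun x => cons (U t x)) =ᶠ[𝓝[>] (0 : ℝ) ⊓ ae volume]
      fun x => cons (v (x / t)) := by
    have h1 : ∀ᶠ x in 𝓝[>] (0 : ℝ) ⊓ ae volume, 0 < x :=
      Filter.Eventually.filter_mono inf_le_left eventually_pos_nhdsGT_zero
    have h2 : ∀ᶠ x in 𝓝[>] (0 : ℝ) ⊓ ae volume, x ∈ Ioi (0 : ℝ) → U t x = v (x / t) :=
      Filter.Eventually.filter_mono inf_le_right hx
    filter_upwards [h1, h2] with x h1 h2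
    rw [h2 h1]
  have := neBot_nhdsGT_inf_ae
  exact tendsto_nhds_unique htr.2 (hlim.congr' heq.symm)

end IsentropicGas

/-! ### The entropy inequality for the generalized Riemann and Cauchy problems -/

theorem mainTheorem4 (κ γ : ℝ) (hκ : 0 < κ) (hγ₁ : 1 < γ) (hγ₃ : γ < 3)
    (d : ℕ) (A : Fin d → ℝ) (hA : ∀ k, 0 < A k)
    (S : ℝ → ℝ) (hS : ConvexOn ℝ Set.univ S) (hSsymm : ∀ v, S v = S (-v)) :
    (∀ (Uhat : Fin d → ℝ × ℝ) (U : Fin d → ℝ → ℝ → ℝ × ℝ) (Ubar : Fin d → ℝ → ℝ × ℝ),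
      (∀ k, Uhat k ∈ IsentropicGas.stateSpace) →
      IsentropicGas.IsGeneralizedRiemannSolution κ γ A Uhat U Ubar →
      ∀ᵐ t ∂(volume.restrict (Set.Ioi (0 : ℝ))),
        ∑ k, A k * IsentropicGas.entropyFlux κ γ S (Ubar k t) ≤ 0) ∧
    (∀ (T : ENNReal) (U0 : Fin d → ℝ × ℝ) (Uhat : Fin d → ℝ → ℝ × ℝ)
      (U : Fin d → ℝ → ℝ → ℝ × ℝ) (Ubar : Fin d → ℝ → ℝ × ℝ),
      0 < T →
      (∀ k, ∀ᵐ x ∂(volume.restrict (Set.Ioi (0 : ℝ))),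
        Uhat k x ∈ IsentropicGas.stateSpace) →
      (∀ k, IntegrableOn (fun x => IsentropicGas.cons (Uhat k x) - U0 k) (Set.Ioi 0)) →
      IsentropicGas.IsGeneralizedCauchySolution κ γ A T U0 Uhat U Ubar →
      ∀ᵐ t ∂(volume.restrict (IsentropicGas.openTimes T)),
        ∑ k, A k * IsentropicGas.entropyFlux κ γ S (Ubar k t) ≤ 0) := by
  refine ⟨fun Uhat U Ubar _ h => ?_, fun T U0 Uhat U Ubar _ _ _ h => ?_⟩
  · obtain ⟨ρs, hρs, hlax⟩ := h.lax
    have hstate : ∀ k, ∀ᵐ t ∂(volume.restrict (Set.Ioi (0 : ℝ))),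
        IsentropicGas.IsJunctionState κ γ ρs (Ubar k t) := by
      intro k
      obtain ⟨v, hv, hU⟩ := hlax k
      obtain ⟨w, hw, hlim⟩ := hv.exists_limit hκ hγ₁ hρs
      filter_upwards [(h.trace k).eq_of_selfSimilar hw.1 hlim hU] with t ht
      rwa [ht]
    filter_upwards [ae_all_iff.2 hstate, h.mass] with t ht hm
    exact IsentropicGas.sum_entropyFlux_nonpos hκ hγ₁ hγ₃ hA hS hSsymm hρs ht hm
  · filter_upwards [h.coupling, h.mass] with t ⟨ρs, hρs, ht⟩ hm
    exact IsentropicGas.sum_entropyFlux_nonpos hκ hγ₁ hγ₃ hA hS hSsymm hρs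
      (fun k => IsentropicGas.isJunctionState_of_mem_boundarySet hκ hγ₁ hρs (ht k)) hm
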